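/- Consider a downlink network with $N\ge 1$ access points (APs) and $M$ clients. Time is slotted, and the slots are grouped into intervals of $\tau\ge 1$ slots. In each slot, the channel from AP $i$ to client $j$ is on with probability $p_{ij}\in[0,1]$, independently over all slots and all pairs $(i,j)$. At the start of each interval every client requests one new packet, and each packet is assigned to one AP. In each slot each AP may transmit one of the packets assigned to it in this interval that it has not delivered yet; the packet of client $j$ sent by AP $i$ is delivered in that slot if and only if the channel $(i,j)$ is on, and the AP then learns whether it was delivered. Packets not delivered by the end of the interval are dropped. A scheduling policy $\eta$ makes the assignments and chooses the transmissions as functions of the whole past history of assignments, transmissions and their outcomes. Let $N_j(k,\eta)\in\{0,1\}$ be the number of packets delivered to client $j$ in interval $k$. Define the timely throughput of client $j$ and the total timely throughput by $$R_j(\eta)=\limsup_{r\to\infty}\frac1r\sum_{k=1}^r N_j(k,\eta),\qquad \mathsf T^3(\eta)=\limsup_{r\to\infty}\frac1r\sum_{k=1}^r\sum_{j=1}^M N_j(k,\eta),$$ where the value of such a limsup means the largest real $R$ such that the limsup is at least $R$ with probability $1$. Write $\|\vec R(\eta)\|_1=\sum_{j=1}^M R_j(\eta)$ and $C_{\mathsf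 T^3}=\sup_\eta \mathsf T^3(\eta)$, the supremum being over all scheduling policies. The relaxed problem is to maximize $\sum_{i,j}x_{ij}$ over $x_{ij}\in\{0,1\}$ subject to $\sum_{j}x_{ij}/p_{ij}\le\tau$ for all $i$ (with $1/0=\infty$ and $0/0=0$) and $\sum_i x_{ij}\le 1$ for all $j$. Let $x$ be an optimal solution, and let each client $j$ belong to the AP $i$ with $x_{ij}=1$ if there is one, and to an arbitrary AP otherwise. Let $\eta_{\mathrm{det}}$ be a corresponding greedy static policy: in every interval, the packet of each client is assigned to the AP to which the client belongs, and each AP transmits the packets assigned to it in decreasing order of $p_{ij}$ (ties broken by any fixed order), repeating each one until it is delivered before moving on to the next. If $C_{\mathsf T^3}\ge \frac{7N}{4}$, then $\mathsf T^3(\eta_{\mathrm{det}})=\|\vec R(\eta_{\mathrm{det}})\|_1$ and $$C_{\mathsf T^3}-N-2\sqrt{N\Big(C_{\mathsf T^3}-\frac{3N}{4}\Big)}\;\le\;\|\vec R(\eta_{\mathrm{det}})\|_1\;\le\;C_{\mathsf T^3}.$$ -/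

import Mathlib

namespace TimelyThroughput

open MeasureTheory Filter

/-- What can be observed in a network with `N` access points and `M` clients:
* `assigned a`: an interval starts, and the new packet of client `j` is given to access point `a j`;
* `slot o`: one time-slot; `o i = none` if access point `i` stayed idle, and `o i = some (j, b)` if
  it transmitted the packet of client `j`, with feedback `b` (`true` means delivered). -/
inductive Event (N M : ℕ) where
  | assigned (a : Fin M → Fin N)
  | slot (o : Fin N → Option (Fin M × Bool))

/-- A history of events, the most recent event first. -/
abbrev History (N M : ℕ) := List (Event N M)

/-- The packets held by access point `i`: those assigned to it at the start of the current
interval that it has not delivered yet. Packets of earlier intervals are dropped. -/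
def buffer {N M : ℕ} : History N M → Fin N → Finset (Fin M)
  | [], _ => ∅
  | .assigned a :: _, i => Finset.univ.filter (fun j => a j = i)
  | .slot o :: h, i => (buffer h i).filter (fun j => o i ≠ some (j, true))

/-- The clients whose packet has been delivered in the current interval. -/
def delivered {N M : ℕ} : History N M → Finset (Fin M)
  | [] => ∅
  | .assigned _ :: _ => ∅
  | .slot o :: h => delivered h ∪ Finset.univ.filter (fun j => ∃ i, o i = some (j, true))

/-- A scheduling policy decides, on the basis of the whole past history, how the packets of an
interval are assigned to the access points, and which packet each access point transmits in a
time-slot (`none`: no transmission). -/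
structure Policy (N M : ℕ) where
  assign : History N M → Fin M → Fin N
  transmit : History N M → Fin N → Option (Fin M)

/-- The packet that access point `i` really transmits after the history `h`. It can only
transmit a packet in its buffer; if the policy names any other packet, it stays idle. -/
def served {N M : ℕ} (η : Policy N M) (h : History N M) (i : Fin N) : Option (Fin M) :=
  (η.transmit h i).filter (fun j => j ∈ buffer h i)

/-- The history after `s` time-slots of an interval that starts with past history `h`. Here
`ch s i j` tells whether the channel from access point `i` to client `j` is on (does not erase) in
time-slot `s` of that interval. -/
def intervalHist {N M : ℕ} (η : Policy N M) (ch : ℕ → Fin N → Fin M → Bool) (h : History N M) :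
    ℕ → History N M
  | 0 => .assigned (η.assign h) :: h
  | s + 1 =>
      .slot (fun i => (served η (intervalHist η ch h s) i).map (fun j => (j, ch s i j)))
        :: intervalHist η ch h s

/-- The history after `r` intervals of `τ` time-slots each; `w t i j` is the state of the channel
`(i, j)` in time-slot `t`, and interval `r` consists of the slots `r * τ, …, r * τ + τ - 1`. -/
def hist {N M : ℕ} (η : Policy N M) (τ : ℕ) (w : ℕ → Fin N → Fin M → Bool) : ℕ → History N M
  | 0 => []
  | r + 1 => intervalHist η (fun s => w (r * τ + s)) (hist η τ w r) τ

/-- `1` if client `j` receives a packet during interval `r` (counted from `0`), else `0`. -/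
def numDelivered {N M : ℕ} (η : Policy N M) (τ : ℕ) (w : ℕ → Fin N → Fin M → Bool)
    (r : ℕ) (j : Fin M) : ℕ :=
  if j ∈ delivered (hist η τ w (r + 1)) then 1 else 0

section Throughput

variable {Ω : Type*} [MeasurableSpace Ω] {N M : ℕ}

/-- The almost sure value of a limsup: the largest `R` such that `limsup X r ≥ R` with
probability one. -/
noncomputable def asLimsup (μ : Measure Ω) (X : ℕ → Ω → ℝ) : ℝ :=
  sSup {R : ℝ | ∀ᵐ ω ∂μ, R ≤ limsup (fun r => X r ω) atTop}

/-- Timely throughput of client `j`: the long-term average number of deliveries to `j` per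
interval. -/
noncomputable def timelyThroughput (μ : Measure Ω) (τ : ℕ) (c : ℕ → Fin N → Fin M → Ω → Bool)
    (η : Policy N M) (j : Fin M) : ℝ :=
  asLimsup μ (fun r ω =>
    (∑ k ∈ Finset.range r, (numDelivered η τ (fun t i j => c t i j ω) k j : ℝ)) / r)

/-- Total timely throughput: the long-term average number of deliveries in the whole network
per interval. -/
noncomputable def totalTimelyThroughput (μ : Measure Ω) (τ : ℕ)
    (c : ℕ → Fin N → Fin M → Ω → Bool) (η : Policy N M) : ℝ :=
  asLimsup μ (fun r ω =>
    (∑ k ∈ Finset.range r, ∑ j, (numDelivered η τ (fun t i j => c t i j ω) k j : ℝ)) / r)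

/-- The supremum of the total timely throughput over all scheduling policies. -/
noncomputable def totalCapacity (μ : Measure Ω) (τ : ℕ)
    (c : ℕ → Fin N → Fin M → Ω → Bool) : ℝ :=
  ⨆ η : Policy N M, totalTimelyThroughput μ τ c η

/-- Packet erasure channels with success probabilities `p i j`: `c t i j` is `true` when the
channel from access point `i` to client `j` is on in time-slot `t`; all these variables are
independent, and `c t i j` is `true` with probability `p i j`. -/
structure IsErasureNetwork (μ : Measure Ω) (p : Fin N → Fin M → ℝ)
    (c : ℕ → Fin N → Fin M → Ω → Bool) : Prop where
  measurable : ∀ t i j, Measurable (c t i j)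
  indep : ProbabilityTheory.iIndepFun
    (fun k : ℕ × Fin N × Fin M => c k.1 k.2.1 k.2.2) μ
  prob : ∀ t i j, μ {ω | c t i j ω = true} = ENNReal.ofReal (p i j)

end Throughput

/-- The static policy of a partition `a` (client `j` belongs to access point `a j`) and orderings
`Γ` (`Γ i k` is the client of rank `k` for access point `i`; only the clients that belong to `i`
matter): each access point always transmits the first packet, in its ordering, that it has not
delivered yet. -/
def staticPolicy {N M : ℕ} (a : Fin M → Fin N) (Γ : Fin N → Equiv.Perm (Fin M)) : Policy N M where
  assign _ := a
  transmit h i := (List.ofFn (Γ i)).find? (fun j => j ∈ buffer h i)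

/-- The orderings are greedy: every access point serves its own clients in decreasing order of
success probability (ties in any order). -/
def IsGreedy {N M : ℕ} (p : Fin N → Fin M → ℝ) (a : Fin M → Fin N)
    (Γ : Fin N → Equiv.Perm (Fin M)) : Prop :=
  ∀ i k l, k < l → a (Γ i k) = i → a (Γ i l) = i → p i (Γ i l) ≤ p i (Γ i k)

/-- Feasible points of the relaxed problem. The sizes `1 / p i j` are extended nonnegative numbers,
so that a packet has infinite size when `p i j = 0`. -/
structure RelaxedFeasible {N M : ℕ} (τ : ℕ) (p : Fin N → Fin M → ℝ)
    (x : Fin N → Fin M → ℕ) : Prop where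
  binary : ∀ i j, x i j = 0 ∨ x i j = 1
  capacity : ∀ i, ∑ j, (x i j : ENNReal) / ENNReal.ofReal (p i j) ≤ (τ : ENNReal)
  once : ∀ j, ∑ i, x i j ≤ 1

/-- Optimal solutions of the relaxed problem. -/
def RelaxedOptimal {N M : ℕ} (τ : ℕ) (p : Fin N → Fin M → ℝ) (x : Fin N → Fin M → ℕ) : Prop :=
  RelaxedFeasible τ p x ∧
    ∀ y : Fin N → Fin M → ℕ, RelaxedFeasible τ p y → ∑ i, ∑ j, y i j ≤ ∑ i, ∑ j, x i j

end TimelyThroughput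

/-!
The argument compares every policy, and the greedy static policy in particular, with the optimum
`D = ∑ x i j` of the relaxed problem.

*Upper bound `C ≤ D + N`.* Fix a policy and the past up to the start of an interval. The
probabilities that the packet of client `j` is delivered by access point `i` in this interval are
feasible for the linear relaxation of the relaxed problem: each transmission to `j` succeeds with
probability `p i j`, independently of the past, and `i` transmits at most `τ` times
(`IsErasureNetwork.integral_deliveries_le`). A vertex of the polytope of the linear relaxation
splits at most `N` clients, so rounding it down loses at most `N`
(`RelaxedOptimal.fractional_le`). Hence the conditional mean number of deliveries per interval never
exceeds `D + N`; a Chernoff bound with the Borel–Cantelli lemma turns this into an almost sure bound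
for the long-term average (`IsErasureNetwork.totalTimelyThroughput_le`).

*Lower bound for the greedy policy.* Under a static policy the intervals are independent and
identically distributed, so by the strong law of large numbers all averages converge, which gives
the equality of the two throughputs, and the limit is the expected number of deliveries in one
interval (`IsErasureNetwork.throughput_staticPolicy`). An access point with `n` clients of the
relaxed solution serves first the `n` clients with the shortest mean service times, whose sum is at
most `τ`. Chebyshev's inequality for the time needed to serve `k` of them shows that fewer than `k`
are delivered with probability at most `k / (n - k)²`; adding these up, the expected number of
deliveries is at least `n - 2 √(n + 1/4)` (`IsCounter.le_mean`,
`IsErasureNetwork.le_integral_counter`). The Cauchy–Schwarz inequality over the access points gives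
`D - 2 √(N (D + N/4))`, an expression that increases in `D ≥ 3N/4`, so that `D` may be replaced by
`C - N` when `C ≥ 7N/4`.
-/

namespace TimelyThroughput

open MeasureTheory Filter ProbabilityTheory

/-! ### Independence of the channel over disjoint time sets -/

section Independence

variable {Ω : Type*} [MeasurableSpace Ω] {μ : Measure Ω} {N M : ℕ}
  {p : Fin N → Fin M → ℝ} {c : ℕ → Fin N → Fin M → Ω → Bool}

/-- The realisation of all channels at the sample point `ω`, as a function of time. -/
def path (c : ℕ → Fin N → Fin M → Ω → Bool) (ω : Ω) : ℕ → Fin N → Fin M → Bool :=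
  fun t i j => c t i j ω

/-- The realisation that agrees with `v` at the times in `I` and is off at all other times. -/
def extendPath (I : Finset ℕ)
    (v : ↥(I ×ˢ (Finset.univ : Finset (Fin N × Fin M))) → Bool) : ℕ → Fin N → Fin M → Bool :=
  fun t i j => if h : t ∈ I then v ⟨(t, i, j), by simpa using h⟩ else false

/-- A function of finitely many time slots factors through a finite type; measurability and
integrability are then automatic. -/
lemma eq_extendPath {β : Type*} {I : Finset ℕ} {f : (ℕ → Fin N → Fin M → Bool) → β}
    (hf : DependsOn f (I : Set ℕ)) (w : ℕ → Fin N → Fin M → Bool) :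
    f w = f (extendPath I fun e => w e.1.1 e.1.2.1 e.1.2.2) := by
  apply hf
  intro t ht
  have ht' : t ∈ I := ht
  funext i j
  simp [extendPath, ht']

lemma IsErasureNetwork.integrable_of_dependsOn [IsProbabilityMeasure μ]
    (hc : IsErasureNetwork μ p c)
    {I : Finset ℕ} {f : (ℕ → Fin N → Fin M → Bool) → ℝ} (hf : DependsOn f (I : Set ℕ)) :
    Integrable (fun ω => f (path c ω)) μ := by
  have h : (fun ω => f (path c ω)) = (fun v => f (extendPath I v)) ∘
      fun ω e => c e.1.1 e.1.2.1 e.1.2.2 ω := by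
    funext ω; exact eq_extendPath hf _
  have hm : Measurable fun ω (e : ↥(I ×ˢ (Finset.univ : Finset (Fin N × Fin M)))) =>
      c e.1.1 e.1.2.1 e.1.2.2 ω := measurable_pi_lambda _ fun e => hc.measurable _ _ _
  rw [h]
  have : IsFiniteMeasure (μ.map fun ω (e : ↥(I ×ˢ (Finset.univ : Finset (Fin N × Fin M)))) =>
      c e.1.1 e.1.2.1 e.1.2.2 ω) := Measure.isFiniteMeasure_map _ _
  exact Integrable.comp_measurable Integrable.of_finite hm

lemma IsErasureNetwork.indepFun_tuples (hc : IsErasureNetwork μ p c) {I J : Finset ℕ}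
    (hIJ : Disjoint I J) :
    IndepFun
      (fun ω (e : ↥(I ×ˢ (Finset.univ : Finset (Fin N × Fin M)))) => c e.1.1 e.1.2.1 e.1.2.2 ω)
      (fun ω (e : ↥(J ×ˢ (Finset.univ : Finset (Fin N × Fin M)))) => c e.1.1 e.1.2.1 e.1.2.2 ω)
      μ := by
  refine hc.indep.indepFun_finset _ _ ?_ fun k => hc.measurable _ _ _
  exact Finset.disjoint_product.2 (Or.inl hIJ)

lemma IsErasureNetwork.indepFun_of_dependsOn (hc : IsErasureNetwork μ p c) {β γ : Type*}
    [MeasurableSpace β] [MeasurableSpace γ] {I J : Finset ℕ} (hIJ : Disjoint I J)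
    {f : (ℕ → Fin N → Fin M → Bool) → β} {g : (ℕ → Fin N → Fin M → Bool) → γ}
    (hf : DependsOn f (I : Set ℕ)) (hg : DependsOn g (J : Set ℕ)) :
    IndepFun (fun ω => f (path c ω)) (fun ω => g (path c ω)) μ := by
  have h := (hc.indepFun_tuples hIJ).comp (φ := fun v => f (extendPath I v))
    (ψ := fun v => g (extendPath J v)) Measurable.of_discrete Measurable.of_discrete
  convert h using 1
  · funext ω; exact eq_extendPath hf _
  · funext ω; exact eq_extendPath hg _

/-- Freezing: if `ψ` sees its two arguments at disjoint finite sets of times only, the two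
arguments may be replaced by independent copies of the channel. -/
lemma IsErasureNetwork.integral_freeze [IsProbabilityMeasure μ] (hc : IsErasureNetwork μ p c)
    {I J : Finset ℕ} (hIJ : Disjoint I J)
    {ψ : (ℕ → Fin N → Fin M → Bool) → (ℕ → Fin N → Fin M → Bool) → ℝ}
    (h₁ : ∀ w', DependsOn (fun w => ψ w w') (I : Set ℕ))
    (h₂ : ∀ w, DependsOn (ψ w) (J : Set ℕ)) :
    ∫ ω, ψ (path c ω) (path c ω) ∂μ = ∫ ω, ∫ ω', ψ (path c ω) (path c ω') ∂μ ∂μ := by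
  set A := fun ω (e : ↥(I ×ˢ (Finset.univ : Finset (Fin N × Fin M)))) => c e.1.1 e.1.2.1 e.1.2.2 ω
    with hA
  set B := fun ω (e : ↥(J ×ˢ (Finset.univ : Finset (Fin N × Fin M)))) => c e.1.1 e.1.2.1 e.1.2.2 ω
    with hB
  have mA : Measurable A := measurable_pi_lambda _ fun e => hc.measurable _ _ _
  have mB : Measurable B := measurable_pi_lambda _ fun e => hc.measurable _ _ _
  have e (ω ω' : Ω) : ψ (path c ω) (path c ω') = ψ (extendPath I (A ω)) (extendPath J (B ω')) :=
    (eq_extendPath (h₁ _) _).trans (eq_extendPath (h₂ _) _)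
  have hi := (indepFun_iff_map_prod_eq_prod_map_map mA.aemeasurable mB.aemeasurable).1
    (hc.indepFun_tuples hIJ)
  have : IsProbabilityMeasure (μ.map A) := Measure.isProbabilityMeasure_map mA.aemeasurable
  have : IsProbabilityMeasure (μ.map B) := Measure.isProbabilityMeasure_map mB.aemeasurable
  simp_rw [e]
  have l : ∫ ω, ψ (extendPath I (A ω)) (extendPath J (B ω)) ∂μ
      = ∫ z, ψ (extendPath I z.1) (extendPath J z.2) ∂((μ.map A).prod (μ.map B)) := by
    rw [← hi, integral_map (mA.prodMk mB).aemeasurable]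
    exact Measurable.of_discrete.aestronglyMeasurable
  rw [l, integral_prod _ Integrable.of_finite, integral_map mA.aemeasurable
    Measurable.of_discrete.aestronglyMeasurable]
  refine integral_congr_ae (ae_of_all _ fun ω => ?_)
  exact integral_map mB.aemeasurable Measurable.of_discrete.aestronglyMeasurable

lemma IsErasureNetwork.map_eq [IsProbabilityMeasure μ] (hc : IsErasureNetwork μ p c)
    (s t : ℕ) (i : Fin N) (j : Fin M) : μ.map (c s i j) = μ.map (c t i j) := by
  have : IsProbabilityMeasure (μ.map (c s i j)) :=
    Measure.isProbabilityMeasure_map (hc.measurable s i j).aemeasurable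
  have : IsProbabilityMeasure (μ.map (c t i j)) :=
    Measure.isProbabilityMeasure_map (hc.measurable t i j).aemeasurable
  have h (t : ℕ) : μ.map (c t i j) {true} = ENNReal.ofReal (p i j) := by
    rw [Measure.map_apply (hc.measurable t i j) (measurableSet_singleton _)]
    exact hc.prob t i j
  have e : ({false} : Set Bool) = {true}ᶜ := by ext b; cases b <;> simp
  refine Measure.ext_of_singleton fun b => ?_
  cases b
  · rw [e, prob_compl_eq_one_sub (measurableSet_singleton _),
      prob_compl_eq_one_sub (measurableSet_singleton _), h, h]
  · rw [h, h]

/-- The channel is stationary: what is observed from time `k` on has the same law as what is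
observed from time `0` on. -/
lemma IsErasureNetwork.identDistrib_shift [IsProbabilityMeasure μ] (hc : IsErasureNetwork μ p c)
    {β : Type*} [MeasurableSpace β] {I : Finset ℕ} {f : (ℕ → Fin N → Fin M → Bool) → β}
    (hf : DependsOn f (I : Set ℕ)) (k : ℕ) :
    IdentDistrib (fun ω => f fun s => path c ω (k + s)) (fun ω => f (path c ω)) μ μ := by
  set A := fun (k : ℕ) ω (e : ↥(I ×ˢ (Finset.univ : Finset (Fin N × Fin M)))) =>
    c (k + e.1.1) e.1.2.1 e.1.2.2 ω with hA
  have mA (k : ℕ) : Measurable (A k) := measurable_pi_lambda _ fun e => hc.measurable _ _ _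
  have law (k : ℕ) : μ.map (A k) = Measure.pi fun e : ↥(I ×ˢ (Finset.univ :
      Finset (Fin N × Fin M))) => μ.map (c 0 e.1.2.1 e.1.2.2) := by
    have hi : iIndepFun (fun (e : ↥(I ×ˢ (Finset.univ : Finset (Fin N × Fin M)))) =>
        c (k + e.1.1) e.1.2.1 e.1.2.2) μ := by
      refine hc.indep.precomp
        (g := fun e : ↥(I ×ˢ (Finset.univ : Finset (Fin N × Fin M))) => (k + e.1.1, e.1.2)) ?_
      rintro ⟨⟨s, x⟩, _⟩ ⟨⟨t, y⟩, _⟩ h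
      simpa using h
    rw [(iIndepFun_iff_map_fun_eq_pi_map fun e => (hc.measurable _ _ _).aemeasurable).1 hi]
    congr 1
    funext e
    exact hc.map_eq _ _ _ _
  have hid : IdentDistrib (A k) (A 0) μ μ :=
    ⟨(mA k).aemeasurable, (mA 0).aemeasurable, (law k).trans (law 0).symm⟩
  have h := hid.comp (u := fun v => f (extendPath I v)) Measurable.of_discrete
  convert h using 1
  · funext ω; exact eq_extendPath hf _
  · funext ω
    rw [eq_extendPath hf (path c ω)]
    simp [A, path]

lemma IsErasureNetwork.measureReal_on (hc : IsErasureNetwork μ p c) (hp : ∀ i j, 0 ≤ p i j)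
    (t : ℕ) (i : Fin N) (j : Fin M) : μ.real {ω | c t i j ω = true} = p i j := by
  rw [Measure.real, hc.prob, ENNReal.toReal_ofReal (hp i j)]

end Independence

/-! ### Histories within an interval -/

section Histories

variable {N M : ℕ} (η : Policy N M)

lemma dependsOn_intervalHist (h : History N M) (k s : ℕ) :
    DependsOn (fun w : ℕ → Fin N → Fin M → Bool => intervalHist η (fun s => w (k + s)) h s)
      (Finset.Ico k (k + s) : Set ℕ) := by
  induction s with
  | zero => intro w w' _; rfl
  | succ s ih =>
    intro w w' hw
    have h₁ : intervalHist η (fun s => w (k + s)) h s = intervalHist η (fun s => w' (k + s)) h s :=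
      ih fun t ht => hw t (by simp only [Finset.coe_Ico, Set.mem_Ico] at ht ⊢; omega)
    have h₂ : w (k + s) = w' (k + s) := hw _ (by simp)
    simp only [intervalHist, h₁, h₂]

lemma dependsOn_delivered (h : History N M) (k s : ℕ) (j : Fin M) :
    DependsOn (fun w : ℕ → Fin N → Fin M → Bool =>
      if j ∈ delivered (intervalHist η (fun s => w (k + s)) h s) then (1 : ℝ) else 0)
      (Finset.Ico k (k + s) : Set ℕ) := fun x y hxy => by
  have := dependsOn_intervalHist η h k s hxy
  simp only at this
  simp only [this]

lemma dependsOn_served (h : History N M) (k s : ℕ) (i : Fin N) (j : Fin M) :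
    DependsOn (fun w : ℕ → Fin N → Fin M → Bool =>
      if served η (intervalHist η (fun s => w (k + s)) h s) i = some j then (1 : ℝ) else 0)
      (Finset.Ico k (k + s) : Set ℕ) := fun x y hxy => by
  have := dependsOn_intervalHist η h k s hxy
  simp only at this
  simp only [this]

lemma dependsOn_hist (τ r : ℕ) :
    DependsOn (fun w : ℕ → Fin N → Fin M → Bool => hist η τ w r)
      (Finset.range (r * τ) : Set ℕ) := by
  induction r with
  | zero => intro w w' _; rfl
  | succ r ih =>
    intro w w' hw
    have h₁ : hist η τ w r = hist η τ w' r :=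
      ih fun t ht => hw t (by
        simp only [Finset.coe_range, Set.mem_Iio, Nat.succ_mul] at ht ⊢; omega)
    simp only [hist, h₁]
    refine dependsOn_intervalHist η _ (r * τ) τ fun t ht => hw t ?_
    simp only [Finset.coe_Ico, Set.mem_Ico, Finset.coe_range, Set.mem_Iio, Nat.succ_mul] at ht ⊢
    omega

lemma mem_buffer_of_served {h : History N M} {i : Fin N} {j : Fin M}
    (hs : served η h i = some j) : j ∈ buffer h i := by
  rw [served, Option.filter_eq_some_iff] at hs
  simpa using hs.2

variable (ch : ℕ → Fin N → Fin M → Bool) (h : History N M)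

lemma mem_buffer_succ {s : ℕ} {i : Fin N} {j : Fin M} :
    j ∈ buffer (intervalHist η ch h (s + 1)) i ↔
      j ∈ buffer (intervalHist η ch h s) i ∧
        ¬ (served η (intervalHist η ch h s) i = some j ∧ ch s i j = true) := by
  simp only [intervalHist, buffer, Finset.mem_filter]
  refine and_congr_right fun _ => not_congr ?_
  simp only [Option.map_eq_some_iff, Prod.mk.injEq]
  constructor
  · rintro ⟨a, ha, rfl, hb⟩; exact ⟨ha, hb⟩
  · rintro ⟨ha, hb⟩; exact ⟨j, ha, rfl, hb⟩

lemma mem_delivered_succ' {s : ℕ} {j : Fin M} :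
    j ∈ delivered (intervalHist η ch h (s + 1)) ↔
      j ∈ delivered (intervalHist η ch h s) ∨
        ∃ i, served η (intervalHist η ch h s) i = some j ∧ ch s i j = true := by
  simp only [intervalHist, delivered, Finset.mem_union, Finset.mem_filter, Finset.mem_univ,
    true_and, Option.map_eq_some_iff, Prod.mk.injEq]
  refine or_congr_right (exists_congr fun i => ?_)
  constructor
  · rintro ⟨a, ha, rfl, hb⟩; exact ⟨ha, hb⟩
  · rintro ⟨ha, hb⟩; exact ⟨j, ha, rfl, hb⟩

/-- Within an interval, the packet of a client is held by the access point it was assigned to, and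
by no other, until it is delivered. -/
lemma mem_buffer_iff {s : ℕ} {i : Fin N} {j : Fin M} :
    j ∈ buffer (intervalHist η ch h s) i ↔
      η.assign h j = i ∧ j ∉ delivered (intervalHist η ch h s) := by
  induction s generalizing i with
  | zero => simp [intervalHist, buffer, delivered]
  | succ s ih =>
    rw [mem_buffer_succ, mem_delivered_succ', ih]
    constructor
    · rintro ⟨⟨rfl, hd⟩, hn⟩
      refine ⟨rfl, ?_⟩
      rintro (hd' | ⟨i', hs, hb⟩)
      · exact hd hd'
      · have := (ih.1 (mem_buffer_of_served η hs)).1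
        subst this
        exact hn ⟨hs, hb⟩
    · rintro ⟨rfl, hn⟩
      push Not at hn
      exact ⟨⟨rfl, hn.1⟩, fun ⟨h₁, h₂⟩ => by simpa [h₂] using hn.2 _ h₁⟩

lemma mem_delivered_succ {s : ℕ} {j : Fin M} :
    j ∈ delivered (intervalHist η ch h (s + 1)) ↔
      j ∈ delivered (intervalHist η ch h s) ∨
        served η (intervalHist η ch h s) (η.assign h j) = some j ∧
          ch s (η.assign h j) j = true := by
  rw [mem_delivered_succ']
  refine or_congr_right ⟨?_, fun hs => ⟨_, hs⟩⟩
  rintro ⟨i, hs, hb⟩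
  obtain rfl := ((mem_buffer_iff η ch h).1 (mem_buffer_of_served η hs)).1
  exact ⟨hs, hb⟩

end Histories

/-! ### The expected number of deliveries in an interval -/

section Expectation

variable {Ω : Type*} [MeasurableSpace Ω] {μ : Measure Ω} [IsProbabilityMeasure μ] {N M : ℕ}
  {p : Fin N → Fin M → ℝ} {c : ℕ → Fin N → Fin M → Ω → Bool}

/-- The channel in a slot is independent of the past. -/
lemma IsErasureNetwork.integral_mul_channel (hc : IsErasureNetwork μ p c)
    (hp : ∀ i j, 0 ≤ p i j) {I : Finset ℕ} {t : ℕ} (ht : t ∉ I)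
    {f : (ℕ → Fin N → Fin M → Bool) → ℝ} (hf : DependsOn f (I : Set ℕ)) (i : Fin N) (j : Fin M) :
    ∫ ω, f (path c ω) * (if path c ω t i j = true then 1 else 0) ∂μ
      = p i j * ∫ ω, f (path c ω) ∂μ := by
  have hI : Disjoint I {t} := Finset.disjoint_singleton_right.2 ht
  have h := hc.integral_freeze hI
    (ψ := fun w w' => f w * (if w' t i j = true then 1 else 0))
    (fun w' x y hxy => by simp only [hf hxy])
    (fun w x y hxy => by simp only [hxy t (by simp)])
  have h1 : ∫ ω, (if path c ω t i j = true then (1 : ℝ) else 0) ∂μ = p i j := by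
    have hm : MeasurableSet {ω | c t i j ω = true} :=
      hc.measurable t i j (measurableSet_singleton true)
    rw [← hc.measureReal_on hp t i j, ← integral_indicator_one hm]
    refine integral_congr_ae (ae_of_all _ fun ω => ?_)
    by_cases hω : c t i j ω = true <;> simp [Set.indicator, path, hω]
  rw [h]
  simp only [integral_const_mul, h1]
  rw [integral_mul_const, mul_comm]

/-- The delivery probability of the packet of client `j` grows in a slot by the probability that
it is transmitted, times the success probability of the channel. -/
lemma IsErasureNetwork.integral_delivered_succ (hc : IsErasureNetwork μ p c)
    (hp : ∀ i j, 0 ≤ p i j) (η : Policy N M) (h : History N M) (k s : ℕ) (j : Fin M) :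
    ∫ ω, (if j ∈ delivered (intervalHist η (fun s => path c ω (k + s)) h (s + 1))
        then (1 : ℝ) else 0) ∂μ
      = ∫ ω, (if j ∈ delivered (intervalHist η (fun s => path c ω (k + s)) h s)
        then (1 : ℝ) else 0) ∂μ
      + p (η.assign h j) j * ∫ ω, (if served η (intervalHist η (fun s => path c ω (k + s)) h s)
          (η.assign h j) = some j then (1 : ℝ) else 0) ∂μ := by
  set i := η.assign h j with hi
  have d₁ := dependsOn_delivered η h k s j
  have d₂ := dependsOn_served η h k s i j
  have d₃ : DependsOn (fun w : ℕ → Fin N → Fin M → Bool =>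
      (if served η (intervalHist η (fun s => w (k + s)) h s) i = some j then (1 : ℝ) else 0)
        * (if w (k + s) i j = true then 1 else 0))
      (Finset.Ico k (k + s + 1) : Set ℕ) := fun x y hxy => by
    have h₁ := d₂ fun t ht => hxy t (by
      simp only [Finset.coe_Ico, Set.mem_Ico] at ht ⊢; omega)
    have h₂ : x (k + s) = y (k + s) := hxy (k + s) (by simp)
    simp only at h₁
    simp only [h₁, h₂]
  rw [← hc.integral_mul_channel hp (t := k + s) (by simp) d₂ i j]
  rw [← integral_add (hc.integrable_of_dependsOn d₁) (hc.integrable_of_dependsOn d₃)]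
  refine integral_congr_ae (ae_of_all _ fun ω => ?_)
  simp only [mem_delivered_succ, ← hi]
  by_cases hd : j ∈ delivered (intervalHist η (fun s => path c ω (k + s)) h s)
  · have hs : served η (intervalHist η (fun s => path c ω (k + s)) h s) i ≠ some j := fun hs =>
      ((mem_buffer_iff η _ h).1 (mem_buffer_of_served η hs)).2 hd
    simp [hd, hs]
  · simp only [hd, false_or, if_false, zero_add, path]
    split_ifs <;> simp_all

end Expectation

/-! ### The integrality gap of the relaxed problem -/

section Rounding

variable {N M : ℕ}

/-- The linear relaxation, with a slack row `none` so that every client is served exactly once. The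
entries with success probability `0` have to vanish, since the division makes their size `0` instead
of `∞`. -/
def fractionalPolytope (τ : ℕ) (p : Fin N → Fin M → ℝ) : Set (Option (Fin N) → Fin M → ℝ) :=
  {u | (∀ o j, 0 ≤ u o j) ∧ (∀ j, ∑ o, u o j = 1) ∧ (∀ i, ∑ j, u (some i) j / p i j ≤ τ) ∧
    ∀ i j, p i j = 0 → u (some i) j = 0}

lemma le_one_of_mem_fractionalPolytope {τ : ℕ} {p : Fin N → Fin M → ℝ}
    {u : Option (Fin N) → Fin M → ℝ} (hu : u ∈ fractionalPolytope τ p) (o : Option (Fin N))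
    (j : Fin M) : u o j ≤ 1 :=
  (Finset.single_le_sum (fun o _ => hu.1 o j) (Finset.mem_univ o)).trans_eq (hu.2.1 j)

lemma isCompact_fractionalPolytope (τ : ℕ) (p : Fin N → Fin M → ℝ) :
    IsCompact (fractionalPolytope τ p) := by
  refine IsCompact.of_isClosed_subset (isCompact_Icc (a := 0) (b := 1)) ?_ fun u hu =>
    ⟨fun o j => hu.1 o j, fun o j => le_one_of_mem_fractionalPolytope hu o j⟩
  simp only [fractionalPolytope, Set.ofPred_and, Set.ofPred_forall]
  refine .inter ?_ (.inter ?_ (.inter ?_ ?_))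
  · exact isClosed_iInter fun o => isClosed_iInter fun j =>
      isClosed_le continuous_const (by fun_prop)
  · exact isClosed_iInter fun j => isClosed_eq (by fun_prop) continuous_const
  · exact isClosed_iInter fun i => isClosed_le
      (continuous_finsetSum _ fun j _ => Continuous.div_const (by fun_prop) _) continuous_const
  · exact isClosed_iInter fun o => isClosed_iInter fun j => isClosed_iInter fun _ =>
      isClosed_eq (by fun_prop) continuous_const

/-- The clients that are split among several rows. -/
noncomputable def splitClients (u : Option (Fin N) → Fin M → ℝ) : Finset (Fin M) :=
  Finset.univ.filter fun j => ∃ o, 0 < u o j ∧ u o j < 1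

/-- The maximum of the linear relaxation is attained at a vertex. -/
lemma exists_vertex {τ : ℕ} {p : Fin N → Fin M → ℝ} {z : Option (Fin N) → Fin M → ℝ}
    (hz : z ∈ fractionalPolytope τ p) :
    ∃ e ∈ fractionalPolytope τ p,
      ∑ i, ∑ j, z (some i) j ≤ ∑ i, ∑ j, e (some i) j ∧
      ∀ d, e + d ∈ fractionalPolytope τ p → e - d ∈ fractionalPolytope τ p → d = 0 := by
  set f : (Option (Fin N) → Fin M → ℝ) → ℝ := fun u => ∑ i, ∑ j, u (some i) j with hf
  have hfc : Continuous f := by fun_prop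
  have hK := isCompact_fractionalPolytope τ p
  obtain ⟨m, hm, hmax⟩ := hK.exists_isMaxOn ⟨z, hz⟩ hfc.continuousOn
  -- an extreme point of the compact face of maximisers
  have hF : IsCompact (fractionalPolytope τ p ∩ {u | f m ≤ f u}) :=
    hK.inter_right (isClosed_le continuous_const hfc)
  obtain ⟨e, he⟩ := hF.extremePoints_nonempty ⟨m, hm, le_refl (f m)⟩
  rw [mem_extremePoints] at he
  obtain ⟨⟨heK, hem⟩, hext⟩ := he
  have hem : f m ≤ f e := hem
  have hmax : ∀ u ∈ fractionalPolytope τ p, f u ≤ f m := fun u hu => hmax hu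
  refine ⟨e, heK, (hmax z hz).trans hem, fun d h₁ h₂ => ?_⟩
  have hadd : f (e + d) + f (e - d) = 2 * f e := by
    simp only [hf, Pi.add_apply, Pi.sub_apply, ← Finset.sum_add_distrib, Finset.mul_sum]
    refine Finset.sum_congr rfl fun i _ => Finset.sum_congr rfl fun j _ => by ring
  have h₃ := hmax _ h₁
  have h₄ := hmax _ h₂
  have := (hext (e + d) ⟨h₁, show f m ≤ f (e + d) by linarith⟩ (e - d)
    ⟨h₂, show f m ≤ f (e - d) by linarith⟩
    ⟨1 / 2, 1 / 2, by norm_num, by norm_num, by norm_num, by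
      rw [← smul_add, add_add_sub_cancel, ← two_smul ℝ e, smul_smul]; norm_num⟩).1
  simpa using this

/-- At a vertex, at most `N` clients are split: a split client has at least two fractional entries,
and the fractional entries are determined by the `N` capacity constraints together with one
equation per split client. -/
lemma card_splitClients_le {τ : ℕ} {p : Fin N → Fin M → ℝ} {e : Option (Fin N) → Fin M → ℝ}
    (he : e ∈ fractionalPolytope τ p)
    (hext : ∀ d, e + d ∈ fractionalPolytope τ p → e - d ∈ fractionalPolytope τ p → d = 0) :
    (splitClients e).card ≤ N := by
  classical
  set F : Finset (Option (Fin N) × Fin M) :=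
    Finset.univ.filter fun z => 0 < e z.1 z.2 ∧ e z.1 z.2 < 1 with hF
  have hle := le_one_of_mem_fractionalPolytope he
  -- each split client accounts for at least two fractional entries
  have h₁ : 2 * (splitClients e).card ≤ F.card := by
    have hmap : ∀ z ∈ F, z.2 ∈ splitClients e := fun z hz => by
      simp only [hF, Finset.mem_filter, Finset.mem_univ, true_and] at hz
      simp only [splitClients, Finset.mem_filter, Finset.mem_univ, true_and]
      exact ⟨_, hz⟩
    rw [Finset.card_eq_sum_card_fiberwise hmap, mul_comm, ← smul_eq_mul]
    refine Finset.card_nsmul_le_sum _ _ _ fun j hj => ?_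
    simp only [splitClients, Finset.mem_filter, Finset.mem_univ, true_and] at hj
    obtain ⟨o, ho₀, ho₁⟩ := hj
    have hsum := he.2.1 j
    rw [← Finset.add_sum_erase _ _ (Finset.mem_univ o)] at hsum
    obtain ⟨o', ho', hpos⟩ : ∃ o' ∈ Finset.univ.erase o, 0 < e o' j :=
      Finset.exists_lt_of_sum_lt (f := fun _ => (0 : ℝ)) (by rw [Finset.sum_const_zero]; linarith)
    have hlt : e o' j < 1 := by
      have := Finset.single_le_sum (fun o _ => he.1 o j) ho'
      linarith
    refine Finset.one_lt_card.2 ⟨(o, j), ?_, (o', j), ?_, ?_⟩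
    · simp [hF, ho₀, ho₁]
    · simp [hF, hpos, hlt]
    · intro h
      exact (Finset.ne_of_mem_erase ho') (congrArg Prod.fst h).symm
  -- otherwise some direction preserves all tight constraints
  suffices h₂ : F.card ≤ N + (splitClients e).card by omega
  by_contra! hlt
  let T : (Option (Fin N) → Fin M → ℝ) →ₗ[ℝ]
      (Fin N → ℝ) × (↥(splitClients e) → ℝ) × (↥Fᶜ → ℝ) :=
    { toFun := fun d => (fun i => ∑ j, d (some i) j / p i j, fun j => ∑ o, d o j,
        fun z => d z.1.1 z.1.2)
      map_add' := fun d d' => by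
        refine Prod.ext ?_ (Prod.ext ?_ ?_) <;> funext x <;>
          simp [Finset.sum_add_distrib, add_div]
      map_smul' := fun r d => by
        refine Prod.ext ?_ (Prod.ext ?_ ?_) <;> funext x <;>
          simp [Finset.mul_sum, mul_div_assoc, mul_add] }
  obtain ⟨d, hdT, hd⟩ : ∃ d, T d = 0 ∧ d ≠ 0 := by
    have hker : LinearMap.ker T ≠ ⊥ := LinearMap.ker_ne_bot_of_finrank_lt (by
      have := F.card_le_univ
      simp only [Fintype.card_prod, Fintype.card_option, Fintype.card_fin] at this
      simp only [Module.finrank_prod, Module.finrank_pi, Module.finrank_pi_fintype,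
        Fintype.card_coe, Fintype.card_fin, Finset.card_compl, Fintype.card_prod,
        Fintype.card_option, Finset.sum_const, Finset.card_univ, smul_eq_mul]
      omega)
    obtain ⟨d, hd, hd0⟩ := Submodule.exists_mem_ne_zero_of_ne_bot hker
    exact ⟨d, hd, hd0⟩
  have hcap : ∀ i, ∑ j, d (some i) j / p i j = 0 := fun i =>
    congrFun (congrArg Prod.fst hdT) i
  have hoff : ∀ o j, (o, j) ∉ F → d o j = 0 := fun o j hz =>
    congrFun (congrArg (fun x => x.2.2) hdT) ⟨(o, j), by simpa using hz⟩
  have hcl : ∀ j, ∑ o, d o j = 0 := fun j => by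
    by_cases hj : j ∈ splitClients e
    · exact congrFun (congrArg (fun x => x.2.1) hdT) ⟨j, hj⟩
    · refine Finset.sum_eq_zero fun o _ => hoff o j fun hz => hj ?_
      simp only [hF, Finset.mem_filter, Finset.mem_univ, true_and] at hz
      simp only [splitClients, Finset.mem_filter, Finset.mem_univ, true_and]
      exact ⟨o, hz⟩
  have hmem : ∀ ε : ℝ, (∀ o j, (o, j) ∈ F → 0 < e o j + ε * d o j) →
      e + ε • d ∈ fractionalPolytope τ p := fun ε hε => by
    refine ⟨fun o j => ?_, fun j => ?_, fun i => ?_, fun i j hij => ?_⟩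
    · by_cases hz : (o, j) ∈ F
      · exact (hε o j hz).le
      · simpa [hoff o j hz] using he.1 o j
    · simp [Finset.sum_add_distrib, ← Finset.mul_sum, hcl, he.2.1]
    · simpa [Finset.sum_add_distrib, add_div, mul_div_assoc, ← Finset.mul_sum, hcap]
        using he.2.2.1 i
    · have h0 := he.2.2.2 i j hij
      have : (some i, j) ∉ F := by simp [hF, h0]
      simp [hoff _ _ this, h0]
  have hev : ∀ᶠ ε : ℝ in nhds 0, ∀ o j, (o, j) ∈ F →
      0 < e o j + ε * d o j ∧ 0 < e o j + (-ε) * d o j := by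
    refine eventually_all.2 fun o => eventually_all.2 fun j => ?_
    by_cases hz : (o, j) ∈ F
    · have hz' := hz
      simp only [hF, Finset.mem_filter, Finset.mem_univ, true_and] at hz'
      have c₁ : Tendsto (fun ε : ℝ => e o j + ε * d o j) (nhds 0) (nhds (e o j + 0 * d o j)) :=
        Continuous.tendsto (by fun_prop) 0
      have c₂ : Tendsto (fun ε : ℝ => e o j + (-ε) * d o j) (nhds 0)
          (nhds (e o j + (-0) * d o j)) := Continuous.tendsto (by fun_prop) 0
      filter_upwards [c₁.eventually_const_lt (by simpa using hz'.1),
        c₂.eventually_const_lt (by simpa using hz'.1)] with ε a b _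
      exact ⟨a, b⟩
    · exact Eventually.of_forall fun ε h => absurd h hz
  obtain ⟨ε, hε, hε0⟩ := ((hev.filter_mono (nhdsWithin_le_nhds (s := Set.Ioi 0))).and
    self_mem_nhdsWithin).exists
  have hε0 : 0 < ε := hε0
  have h0 := hext (ε • d) (hmem ε fun o j hz => (hε o j hz).1) (by
    have := hmem (-ε) fun o j hz => (hε o j hz).2
    rwa [neg_smul, ← sub_eq_add_neg] at this)
  exact hd ((smul_eq_zero.1 h0).resolve_left hε0.ne')

/-- The linear relaxation exceeds the optimum of the relaxed (integer) problem by at most `N`: drop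
the clients that are split at an optimal vertex. -/
lemma RelaxedOptimal.fractional_le {τ : ℕ} {p : Fin N → Fin M → ℝ} (hp : ∀ i j, 0 ≤ p i j)
    {x : Fin N → Fin M → ℕ} (hx : RelaxedOptimal τ p x) {z : Fin N → Fin M → ℝ}
    (hz₀ : ∀ i j, 0 ≤ z i j) (hz₁ : ∀ j, ∑ i, z i j ≤ 1) (hzc : ∀ i, ∑ j, z i j / p i j ≤ τ)
    (hzp : ∀ i j, p i j = 0 → z i j = 0) :
    ∑ i, ∑ j, z i j ≤ ∑ i, ∑ j, (x i j : ℝ) + N := by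
  classical
  let u : Option (Fin N) → Fin M → ℝ := fun o j => o.elim (1 - ∑ i, z i j) fun i => z i j
  have hu : u ∈ fractionalPolytope τ p := by
    refine ⟨fun o j => ?_, fun j => ?_, hzc, hzp⟩
    · cases o
      · simpa [u] using hz₁ j
      · exact hz₀ _ _
    · simp [u, Fintype.sum_option]
  obtain ⟨e, he, hue, hext⟩ := exists_vertex hu
  have hcard := card_splitClients_le he hext
  let y : Fin N → Fin M → ℕ := fun i j => if e (some i) j = 1 then 1 else 0
  have hsome : ∀ j, ∑ i, e (some i) j ≤ 1 := fun j => by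
    have := he.2.1 j
    rw [Fintype.sum_option] at this
    linarith [he.1 none j]
  have hye : ∀ i j, (y i j : ℝ) ≤ e (some i) j := fun i j => by
    simp only [y]; split_ifs with h
    · simp [h]
    · simpa using he.1 _ _
  have hy : RelaxedFeasible τ p y := by
    refine ⟨fun i j => ?_, fun i => ?_, fun j => ?_⟩
    · simp only [y]; split_ifs <;> simp
    · calc ∑ j, (y i j : ENNReal) / ENNReal.ofReal (p i j)
          ≤ ∑ j, ENNReal.ofReal (e (some i) j / p i j) := by
            refine Finset.sum_le_sum fun j _ => ?_
            simp only [y]; split_ifs with h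
            · have hpij : 0 < p i j := lt_of_le_of_ne (hp i j) fun h0 => by
                have := he.2.2.2 i j h0.symm
                rw [h] at this; exact one_ne_zero this
              rw [ENNReal.ofReal_div_of_pos hpij, h]; simp
            · simp
        _ = ENNReal.ofReal (∑ j, e (some i) j / p i j) :=
            (ENNReal.ofReal_sum_of_nonneg fun j _ => div_nonneg (he.1 _ _) (hp _ _)).symm
        _ ≤ ENNReal.ofReal τ := ENNReal.ofReal_le_ofReal (he.2.2.1 i)
        _ = τ := ENNReal.ofReal_natCast τ
    · have : ((∑ i, y i j : ℕ) : ℝ) ≤ 1 := by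
        push_cast
        exact (Finset.sum_le_sum fun i _ => hye i j).trans (hsome j)
      exact_mod_cast this
  have hopt : (∑ i, ∑ j, (y i j : ℝ)) ≤ ∑ i, ∑ j, (x i j : ℝ) := by exact_mod_cast hx.2 y hy
  have hloss : ∑ i, ∑ j, e (some i) j ≤ ∑ i, ∑ j, (y i j : ℝ) + (splitClients e).card := by
    rw [Finset.sum_comm, Finset.sum_comm (f := fun i j => (y i j : ℝ)),
      Finset.cast_card, ← Finset.sum_filter_add_sum_filter_not Finset.univ (· ∈ splitClients e)
        (fun j => ∑ i, e (some i) j),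
      ← Finset.sum_filter_add_sum_filter_not Finset.univ (· ∈ splitClients e)
        (fun j => ∑ i, (y i j : ℝ)), Finset.filter_univ_mem]
    have a : ∑ j ∈ splitClients e, ∑ i, e (some i) j ≤ ∑ j ∈ splitClients e, (1 : ℝ) :=
      Finset.sum_le_sum fun j _ => hsome j
    have b : (0 : ℝ) ≤ ∑ j ∈ splitClients e, ∑ i, (y i j : ℝ) := by positivity
    have d : ∑ j with j ∉ splitClients e, ∑ i, e (some i) j
        ≤ ∑ j with j ∉ splitClients e, ∑ i, (y i j : ℝ) := by
      refine Finset.sum_le_sum fun j hj => Finset.sum_le_sum fun i _ => ?_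
      simp only [splitClients, Finset.mem_filter, Finset.mem_univ, true_and, not_exists,
        not_and, not_lt] at hj
      rcases (he.1 (some i) j).eq_or_lt with h0 | h0
      · rw [← h0]; positivity
      · have : e (some i) j = 1 :=
          le_antisymm (le_one_of_mem_fractionalPolytope he _ _) (hj _ h0)
        simp [y, this]
    linarith
  have hcard' : ((splitClients e).card : ℝ) ≤ N := by exact_mod_cast hcard
  have : ∑ i, ∑ j, z i j ≤ ∑ i, ∑ j, e (some i) j := hue
  linarith

end Rounding

/-! ### The upper bound on the total timely throughput -/

/-- An almost sure eventual upper bound is an upper bound for the almost sure limsup. -/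
lemma asLimsup_le {Ω : Type*} [MeasurableSpace Ω] {μ : Measure Ω} [NeZero μ]
    {X : ℕ → Ω → ℝ} {L : ℝ} (hL : 0 ≤ L) (hX : ∀ r ω, 0 ≤ X r ω)
    (h : ∀ ε > 0, ∀ᵐ ω ∂μ, ∀ᶠ r in atTop, X r ω ≤ L + ε) : asLimsup μ X ≤ L := by
  refine Real.sSup_le (fun R hR => le_of_forall_pos_le_add fun ε hε => ?_) hL
  have hR : ∀ᵐ ω ∂μ, R ≤ limsup (fun r => X r ω) atTop := hR
  obtain ⟨ω, h₁, h₂⟩ := (hR.and (h ε hε)).exists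
  exact h₁.trans (limsup_le_of_le
    (IsCoboundedUnder.of_frequently_ge (Frequently.of_forall fun r => hX r ω)) h₂)

section UpperBound

variable {Ω : Type*} [MeasurableSpace Ω] {μ : Measure Ω} [IsProbabilityMeasure μ] {N M τ : ℕ}
  {p : Fin N → Fin M → ℝ} {c : ℕ → Fin N → Fin M → Ω → Bool}

/-- Whatever the past, the expected number of deliveries in an interval is at most the optimum of
the relaxed problem plus `N`: the delivery probabilities are feasible for the linear relaxation,
since each access point makes at most `τ` transmissions. -/
lemma IsErasureNetwork.integral_deliveries_le (hc : IsErasureNetwork μ p c)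
    (hp : ∀ i j, 0 ≤ p i j) {x : Fin N → Fin M → ℕ} (hx : RelaxedOptimal τ p x)
    (η : Policy N M) (h : History N M) (k : ℕ) :
    ∫ ω, ∑ j, (if j ∈ delivered (intervalHist η (fun s => path c ω (k + s)) h τ)
      then (1 : ℝ) else 0) ∂μ ≤ ∑ i, ∑ j, (x i j : ℝ) + N := by
  set P : Fin M → ℕ → ℝ := fun j s =>
    ∫ ω, (if j ∈ delivered (intervalHist η (fun s => path c ω (k + s)) h s)
      then (1 : ℝ) else 0) ∂μ with hP
  set S : Fin M → ℕ → ℝ := fun j s =>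
    ∫ ω, (if served η (intervalHist η (fun s => path c ω (k + s)) h s) (η.assign h j) = some j
      then (1 : ℝ) else 0) ∂μ with hS
  have hS₀ : ∀ j s, 0 ≤ S j s := fun j s => integral_nonneg fun ω => by
    simp only [Pi.zero_apply]; split_ifs <;> norm_num
  have hP₀ : ∀ j s, 0 ≤ P j s := fun j s => integral_nonneg fun ω => by
    simp only [Pi.zero_apply]; split_ifs <;> norm_num
  have hP₁ : ∀ j s, P j s ≤ 1 := fun j s => by
    calc P j s ≤ ∫ _, (1 : ℝ) ∂μ := by
          refine integral_mono (hc.integrable_of_dependsOn (dependsOn_delivered η h k s j))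
            (integrable_const _) fun ω => ?_
          simp only; split_ifs <;> norm_num
      _ = 1 := by simp
  have hPS : ∀ j s, P j s = p (η.assign h j) j * ∑ t ∈ Finset.range s, S j t := by
    intro j s
    induction s with
    | zero => simp [hP, intervalHist, delivered]
    | succ s ih =>
      rw [Finset.sum_range_succ, mul_add, ← ih]
      exact hc.integral_delivered_succ hp η h k s j
  let z : Fin N → Fin M → ℝ := fun i j => if η.assign h j = i then P j τ else 0
  have hz : ∀ j, ∑ i, z i j = P j τ := fun j => by simp [z]
  have key := hx.fractional_le hp (z := z)
    (fun i j => by simp only [z]; split_ifs; exacts [hP₀ _ _, le_rfl])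
    (fun j => by rw [hz]; exact hP₁ _ _)
    (fun i => by
      calc ∑ j, z i j / p i j
          ≤ ∑ j, ∑ s ∈ Finset.range τ, (if η.assign h j = i then S j s else 0) := by
            refine Finset.sum_le_sum fun j _ => ?_
            by_cases hij : η.assign h j = i
            · simp only [z, hij, if_true]
              rw [hPS, hij]
              rcases (hp i j).eq_or_lt with h0 | h0
              · rw [← h0]; simpa using Finset.sum_nonneg fun s _ => hS₀ j s
              · rw [mul_div_cancel_left₀ _ h0.ne']
            · simp [z, hij]
        _ = ∑ s ∈ Finset.range τ, ∑ j, (if η.assign h j = i then S j s else 0) :=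
            Finset.sum_comm
        _ ≤ ∑ s ∈ Finset.range τ, (1 : ℝ) := by
            refine Finset.sum_le_sum fun s _ => ?_
            calc ∑ j, (if η.assign h j = i then S j s else 0)
                ≤ ∑ j, ∫ ω, (if served η (intervalHist η (fun s => path c ω (k + s)) h s) i
                    = some j then (1 : ℝ) else 0) ∂μ := by
                  refine Finset.sum_le_sum fun j _ => ?_
                  split_ifs with hij
                  · rw [← hij]
                  · exact integral_nonneg fun ω => by
                      simp only [Pi.zero_apply]; split_ifs <;> norm_num
              _ = ∫ ω, ∑ j, (if served η (intervalHist η (fun s => path c ω (k + s)) h s) i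
                    = some j then (1 : ℝ) else 0) ∂μ :=
                  (integral_finsetSum _ fun j _ =>
                    hc.integrable_of_dependsOn (dependsOn_served η h k s i j)).symm
              _ ≤ ∫ _, (1 : ℝ) ∂μ := by
                  refine integral_mono (integrable_finsetSum _ fun j _ =>
                    hc.integrable_of_dependsOn (dependsOn_served η h k s i j))
                    (integrable_const _) fun ω => ?_
                  simp only
                  cases served η (intervalHist η (fun s => path c ω (k + s)) h s) i <;> simp
              _ = 1 := by simp
        _ = τ := by simp)
    (fun i j hij => by
      simp only [z]; split_ifs with ha
      · rw [hPS, ha, hij, zero_mul]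
      · rfl)
  rw [integral_finsetSum _ fun j _ => hc.integrable_of_dependsOn (dependsOn_delivered η h k τ j)]
  rw [Finset.sum_comm] at key
  simpa only [hz] using key

/-- The number of packets delivered in interval `r` (counted from `0`) in the whole network. -/
noncomputable def deliveries (η : Policy N M) (τ : ℕ) (w : ℕ → Fin N → Fin M → Bool) (r : ℕ) : ℝ :=
  ∑ j, (numDelivered η τ w r j : ℝ)

lemma sum_ite_le (A : Finset (Fin M)) :
    ∑ j, (if j ∈ A then (1 : ℝ) else 0) ≤ M := by
  calc ∑ j, (if j ∈ A then (1 : ℝ) else 0) ≤ ∑ _j : Fin M, (1 : ℝ) :=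
        Finset.sum_le_sum fun j _ => by split_ifs <;> norm_num
    _ = M := by simp

lemma deliveries_eq (η : Policy N M) (w : ℕ → Fin N → Fin M → Bool) (r : ℕ) :
    deliveries η τ w r = ∑ j, (if j ∈ delivered
      (intervalHist η (fun s => w (r * τ + s)) (hist η τ w r) τ) then (1 : ℝ) else 0) := by
  simp only [deliveries, numDelivered, Nat.cast_ite, Nat.cast_one, Nat.cast_zero]
  rfl

lemma dependsOn_numDelivered (η : Policy N M) (r : ℕ) (j : Fin M) :
    DependsOn (fun w : ℕ → Fin N → Fin M → Bool => numDelivered η τ w r j)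
      (Finset.range ((r + 1) * τ) : Set ℕ) := fun x y hxy => by
  have := dependsOn_hist η τ (r + 1) hxy
  simp only at this
  simp only [numDelivered, this]

lemma dependsOn_exp_sum_deliveries (η : Policy N M) (l a : ℝ) (r : ℕ) :
    DependsOn (fun w : ℕ → Fin N → Fin M → Bool => Real.exp (l *
      ∑ k ∈ Finset.range r, (deliveries η τ w k - a))) (Finset.range (r * τ) : Set ℕ) := by
  intro w w' hw
  simp only
  congr 2
  refine Finset.sum_congr rfl fun k hk => ?_
  congr 1
  refine Finset.sum_congr rfl fun j _ => ?_
  have : numDelivered η τ w k j = numDelivered η τ w' k j :=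
    dependsOn_numDelivered η k j fun t ht => hw t (by
      simp only [Finset.coe_range, Set.mem_Iio] at ht ⊢
      exact ht.trans_le (Nat.mul_le_mul_right _ (Finset.mem_range.1 hk)))
  rw [this]

/-- One step of the exponential supermartingale behind the Chernoff bound. With `B = M + L + ε`,
which bounds the deviation from `L + ε`, and the exponent `l = ε / (2 B²)`, which is at most
`1 / B`, the inequality `exp y ≤ 1 + y + y²` for `|y| ≤ 1` gives `1 - l ε + l² B² = 1 - ε² / (4 B²)`. -/
lemma IsErasureNetwork.integral_exp_deliveries_le (hc : IsErasureNetwork μ p c) (η : Policy N M)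
    {L ε : ℝ} (hL : 0 ≤ L) (hε : 0 < ε)
    (hmean : ∀ (h : History N M) (k : ℕ), ∫ ω, ∑ j, (if j ∈ delivered (intervalHist η
      (fun s => path c ω (k + s)) h τ) then (1 : ℝ) else 0) ∂μ ≤ L) (h : History N M) (k : ℕ) :
    ∫ ω, Real.exp (ε / (2 * (M + L + ε) ^ 2) * (∑ j, (if j ∈ delivered (intervalHist η
      (fun s => path c ω (k + s)) h τ) then (1 : ℝ) else 0) - (L + ε))) ∂μ
      ≤ 1 - ε ^ 2 / (4 * (M + L + ε) ^ 2) := by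
  set B : ℝ := M + L + ε with hB
  have hM : (0 : ℝ) ≤ M := Nat.cast_nonneg M
  have hB₀ : 0 < B := by positivity
  set X : Ω → ℝ := fun ω => ∑ j, (if j ∈ delivered (intervalHist η
      (fun s => path c ω (k + s)) h τ) then (1 : ℝ) else 0) with hX
  have hX₀ : ∀ ω, 0 ≤ X ω := fun ω => Finset.sum_nonneg fun j _ => by split_ifs <;> norm_num
  have hX₁ : ∀ ω, X ω ≤ M := fun ω => sum_ite_le _
  have hXi : Integrable X μ := integrable_finsetSum _ fun j _ =>
    hc.integrable_of_dependsOn (dependsOn_delivered η h k τ j)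
  have hεB : ε ≤ B := by rw [hB]; linarith
  set l : ℝ := ε / (2 * B ^ 2) with hl
  have hl₀ : 0 < l := by positivity
  have hlB : l * B ≤ 1 := by
    rw [hl, div_mul_eq_mul_div, div_le_one (by positivity)]
    nlinarith
  have hpt : ∀ ω, Real.exp (l * (X ω - (L + ε))) ≤ 1 + l * (X ω - (L + ε)) + l ^ 2 * B ^ 2 := by
    intro ω
    have habs : |X ω - (L + ε)| ≤ B := by
      rw [abs_le, hB]
      constructor
      · linarith [hX₀ ω]
      · linarith [hX₁ ω]
    have habs' : |l * (X ω - (L + ε))| ≤ 1 := by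
      rw [abs_mul, abs_of_pos hl₀]
      exact (mul_le_mul_of_nonneg_left habs hl₀.le).trans hlB
    have h1 := (abs_le.1 (Real.abs_exp_sub_one_sub_id_le habs')).2
    have h2 : (l * (X ω - (L + ε))) ^ 2 ≤ l ^ 2 * B ^ 2 := by
      rw [mul_pow]
      exact mul_le_mul_of_nonneg_left (sq_le_sq' (abs_le.1 habs).1 (abs_le.1 habs).2)
        (sq_nonneg l)
    linarith
  calc ∫ ω, Real.exp (l * (X ω - (L + ε))) ∂μ
      ≤ ∫ ω, (1 + l * (X ω - (L + ε)) + l ^ 2 * B ^ 2) ∂μ := by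
        refine integral_mono_of_nonneg (ae_of_all _ fun ω => (Real.exp_pos _).le) ?_
          (ae_of_all _ hpt)
        fun_prop
    _ = 1 + l * (∫ ω, X ω ∂μ - (L + ε)) + l ^ 2 * B ^ 2 := by
        rw [integral_add (by fun_prop) (by fun_prop), integral_add (by fun_prop) (by fun_prop),
          integral_const_mul, integral_sub hXi (by fun_prop)]
        simp
    _ ≤ 1 + l * (-ε) + l ^ 2 * B ^ 2 := by
        have : ∫ ω, X ω ∂μ ≤ L := hmean h k
        gcongr
        linarith
    _ = 1 - ε ^ 2 / (4 * B ^ 2) := by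
        rw [hl]; field_simp; ring

lemma IsErasureNetwork.integral_exp_sum_deliveries_le (hc : IsErasureNetwork μ p c)
    (η : Policy N M) {L ε : ℝ} (hL : 0 ≤ L) (hε : 0 < ε)
    (hmean : ∀ (h : History N M) (k : ℕ), ∫ ω, ∑ j, (if j ∈ delivered (intervalHist η
      (fun s => path c ω (k + s)) h τ) then (1 : ℝ) else 0) ∂μ ≤ L) (r : ℕ) :
    ∫ ω, Real.exp (ε / (2 * (M + L + ε) ^ 2) *
      ∑ k ∈ Finset.range r, (deliveries η τ (path c ω) k - (L + ε))) ∂μ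
      ≤ (1 - ε ^ 2 / (4 * (M + L + ε) ^ 2)) ^ r := by
  set l : ℝ := ε / (2 * (M + L + ε) ^ 2) with hl
  set ρ : ℝ := 1 - ε ^ 2 / (4 * (M + L + ε) ^ 2) with hρ
  have hstep := hc.integral_exp_deliveries_le η hL hε hmean
  have hρ₀ : 0 ≤ ρ := (integral_nonneg fun ω => (Real.exp_pos _).le).trans (hstep [] 0)
  have hdep := dependsOn_exp_sum_deliveries η (τ := τ) l (L + ε)
  induction r with
  | zero => simp
  | succ r ih =>
    have hdisj : Disjoint (Finset.range (r * τ)) (Finset.Ico (r * τ) (r * τ + τ)) := by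
      rw [Finset.disjoint_left]
      intro t ht ht'
      simp only [Finset.mem_range, Finset.mem_Ico] at ht ht'
      omega
    have hfr := hc.integral_freeze hdisj
      (ψ := fun w w' => Real.exp (l * ∑ k ∈ Finset.range r, (deliveries η τ w k - (L + ε))) *
        Real.exp (l * (∑ j, (if j ∈ delivered (intervalHist η (fun s => w' (r * τ + s))
          (hist η τ w r) τ) then (1 : ℝ) else 0) - (L + ε))))
      (fun w' x y hxy => by
        have h₁ := hdep r hxy
        have h₂ := dependsOn_hist η τ r hxy
        simp only at h₁ h₂
        simp only [h₁, h₂])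
      (fun w x y hxy => by
        have h₁ := dependsOn_intervalHist η (hist η τ w r) (r * τ) τ hxy
        simp only at h₁
        simp only [h₁])
    calc _ = ∫ ω, Real.exp (l * ∑ k ∈ Finset.range r, (deliveries η τ (path c ω) k - (L + ε))) *
        Real.exp (l * (∑ j, (if j ∈ delivered (intervalHist η (fun s => path c ω (r * τ + s))
          (hist η τ (path c ω) r) τ) then (1 : ℝ) else 0) - (L + ε))) ∂μ := by
          refine integral_congr_ae (ae_of_all _ fun ω => ?_)
          simp only [Finset.sum_range_succ, mul_add, Real.exp_add, deliveries_eq _ _ r]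
      _ ≤ ∫ ω, Real.exp (l * ∑ k ∈ Finset.range r, (deliveries η τ (path c ω) k - (L + ε)))
            * ρ ∂μ := by
          rw [hfr]
          refine integral_mono_of_nonneg (ae_of_all _ fun ω => integral_nonneg fun ω' => by
            positivity) ((hc.integrable_of_dependsOn (hdep r)).mul_const ρ)
            (ae_of_all _ fun ω => ?_)
          simp only
          rw [integral_const_mul]
          exact mul_le_mul_of_nonneg_left (hstep _ _) (Real.exp_pos _).le
      _ ≤ ρ ^ (r + 1) := by
          rw [integral_mul_const, pow_succ]
          exact mul_le_mul_of_nonneg_right ih hρ₀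

/-- If the expected number of deliveries per interval is at most `L` whatever the past, then the
total timely throughput is at most `L`: by Chernoff's bound and the Borel–Cantelli lemma, the
average is almost surely eventually below `L + ε`. -/
lemma IsErasureNetwork.totalTimelyThroughput_le (hc : IsErasureNetwork μ p c)
    (η : Policy N M) {L : ℝ} (hL : 0 ≤ L)
    (hmean : ∀ (h : History N M) (k : ℕ), ∫ ω, ∑ j, (if j ∈ delivered (intervalHist η
      (fun s => path c ω (k + s)) h τ) then (1 : ℝ) else 0) ∂μ ≤ L) :
    totalTimelyThroughput μ τ c η ≤ L := by
  refine asLimsup_le hL (fun r ω => by positivity) fun ε hε => ?_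
  set l : ℝ := ε / (2 * (M + L + ε) ^ 2) with hl
  set ρ : ℝ := 1 - ε ^ 2 / (4 * (M + L + ε) ^ 2) with hρ
  have hM : (0 : ℝ) ≤ M := Nat.cast_nonneg M
  have hl₀ : 0 < l := by positivity
  have hρ₁ : ρ < 1 := by rw [hρ, sub_lt_self_iff]; positivity
  have hρ₀ : 0 ≤ ρ := (integral_nonneg fun ω => (Real.exp_pos _).le).trans
    (hc.integral_exp_deliveries_le η hL hε hmean [] 0)
  set Y : ℕ → Ω → ℝ := fun r ω =>
    ∑ k ∈ Finset.range r, (deliveries η τ (path c ω) k - (L + ε)) with hY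
  have hdep := dependsOn_exp_sum_deliveries η (τ := τ) l (L + ε)
  have htail : ∀ r, μ {ω | 1 ≤ Real.exp (l * Y r ω)} ≤ ENNReal.ofReal ρ ^ r := by
    intro r
    have h₁ := mul_meas_ge_le_integral_of_nonneg (μ := μ) (f := fun ω => Real.exp (l * Y r ω))
      (ae_of_all _ fun ω => (Real.exp_pos _).le) (hc.integrable_of_dependsOn (hdep r)) 1
    rw [one_mul] at h₁
    rw [← ENNReal.ofReal_pow hρ₀, ← ofReal_measureReal]
    exact ENNReal.ofReal_le_ofReal
      (h₁.trans (hc.integral_exp_sum_deliveries_le η hL hε hmean r))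
  have hsum : ∑' r, μ {ω | 1 ≤ Real.exp (l * Y r ω)} ≠ ⊤ := by
    refine ne_top_of_le_ne_top ?_ (ENNReal.tsum_le_tsum htail)
    rw [ENNReal.tsum_geometric]
    simpa [tsub_eq_zero_iff_le] using hρ₁
  filter_upwards [ae_eventually_notMem hsum] with ω hω
  filter_upwards [hω, eventually_gt_atTop 0] with r hr hr₀
  have hneg : Y r ω < 0 := by
    by_contra! h
    exact hr (Real.one_le_exp (mul_nonneg hl₀.le h))
  have hr' : (0 : ℝ) < r := by exact_mod_cast hr₀
  rw [div_le_iff₀ hr']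
  simp only [hY, Finset.sum_sub_distrib, Finset.sum_const, Finset.card_range, nsmul_eq_mul]
    at hneg
  have : ∑ k ∈ Finset.range r, deliveries η τ (path c ω) k ≤ (L + ε) * r := by linarith
  exact this

end UpperBound

/-! ### Serving packets one after the other -/

section Chain

/-- `∑_{j ≥ r} 1 / j²` telescopes against `1 / (r - 1/2)`. -/
lemma sum_Ico_inv_sq_le {r n : ℕ} (hr : 1 ≤ r) (hrn : r ≤ n) :
    ∑ j ∈ Finset.Ico r n, (1 : ℝ) / j ^ 2 ≤ 1 / (r - 1 / 2) - 1 / (n - 1 / 2) := by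
  induction n, hrn using Nat.le_induction with
  | base => simp
  | succ n hn ih =>
    rw [Finset.sum_Ico_succ_top hn]
    have h1 : (1 : ℝ) ≤ n := by exact_mod_cast hr.trans hn
    have h2 : (1 : ℝ) / n ^ 2 ≤ 1 / (n - 1 / 2) - 1 / (n + 1 - 1 / 2) := by
      rw [div_sub_div _ _ (by linarith) (by linarith), div_le_div_iff₀ (by positivity)
        (mul_pos (by linarith) (by linarith))]
      nlinarith
    push_cast
    linarith

/-- Chebyshev's bounds for the individual packets add up. The bound `(n - j) / j²` is
less than `1` exactly when `j > √(n + 1/4) - 1/2`, which is where the sum is split. -/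
lemma sum_tail_bound_le {n : ℕ} {g : ℕ → ℝ} (h₁ : ∀ j < n, g j ≤ 1)
    (h₂ : ∀ j < n, g j * j ^ 2 ≤ n - j) :
    ∑ j ∈ Finset.range n, g j ≤ 2 * √(n + 1 / 4) := by
  set s : ℝ := √(n + 1 / 4) with hs
  have hs₀ : 0 ≤ s := Real.sqrt_nonneg _
  have hs₂ : s ^ 2 = n + 1 / 4 := Real.sq_sqrt (by positivity)
  have htriv : ∀ m ≤ n, ∑ j ∈ Finset.range m, g j ≤ m := fun m hm => by
    calc ∑ j ∈ Finset.range m, g j ≤ ∑ _j ∈ Finset.range m, (1 : ℝ) :=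
          Finset.sum_le_sum fun j hj => h₁ j ((Finset.mem_range.1 hj).trans_le hm)
      _ = m := by simp
  have hg : ∀ j < n, 1 ≤ j → g j ≤ (n - j) / j ^ 2 := fun j hj hj1 => by
    have : (0 : ℝ) < j := by exact_mod_cast hj1
    rw [le_div_iff₀ (by positivity)]
    exact h₂ j hj
  -- the estimate of the tail needs `n ≥ 6`; for `n ≤ 4` even the trivial bound `n` is enough
  rcases le_or_gt n 4 with hn | hn
  · have hn' : (n : ℝ) ≤ 4 := by exact_mod_cast hn
    have hn₀ : (0 : ℝ) ≤ n := Nat.cast_nonneg n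
    refine (htriv n le_rfl).trans ?_
    nlinarith
  rcases eq_or_lt_of_le (Nat.succ_le_of_lt hn) with hn5 | hn6
  · have hn5 : n = 5 := hn5.symm
    subst hn5
    have a := htriv 2 (by norm_num)
    have b₂ := hg 2 (by norm_num) (by norm_num)
    have b₃ := hg 3 (by norm_num) (by norm_num)
    have b₄ := hg 4 (by norm_num) (by norm_num)
    norm_num [Finset.sum_range_succ] at a b₂ b₃ b₄ hs₂ ⊢
    nlinarith
  · have hn6 : (6 : ℝ) ≤ n := by exact_mod_cast hn6
    have hs25 : 5 / 2 ≤ s := by nlinarith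
    set r : ℕ := ⌈s - 1 / 2⌉₊ with hr
    have hr_le : s - 1 / 2 ≤ r := Nat.le_ceil _
    have hr_lt : (r : ℝ) < s + 1 / 2 := by
      have := Nat.ceil_lt_add_one (a := s - 1 / 2) (by linarith)
      linarith
    have hr1 : 1 ≤ r := by
      have : (1 : ℝ) ≤ r := by linarith
      exact_mod_cast this
    have hrn : r ≤ n := by
      have : (r : ℝ) ≤ n := by nlinarith
      exact_mod_cast this
    have hu : (0 : ℝ) < r - 1 / 2 := by linarith
    have hv : (0 : ℝ) < n - 1 / 2 := by linarith
    have htail : ∑ j ∈ Finset.Ico r n, g j ≤ n * (1 / (r - 1 / 2) - 1 / (n - 1 / 2)) := by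
      calc ∑ j ∈ Finset.Ico r n, g j ≤ ∑ j ∈ Finset.Ico r n, (n : ℝ) * (1 / j ^ 2) := by
            refine Finset.sum_le_sum fun j hj => ?_
            rw [Finset.mem_Ico] at hj
            refine (hg j hj.2 (hr1.trans hj.1)).trans ?_
            rw [mul_one_div]
            gcongr
            simp
        _ ≤ _ := by
            rw [← Finset.mul_sum]
            exact mul_le_mul_of_nonneg_left (sum_Ico_inv_sq_le hr1 hrn) (Nat.cast_nonneg n)
    have hone : 1 ≤ n * (1 / ((n : ℝ) - 1 / 2)) := by
      rw [mul_one_div, le_div_iff₀ hv]; linarith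
    have hmid : n * (1 / ((r : ℝ) - 1 / 2)) ≤ 2 * s + 1 - r := by
      rw [mul_one_div, div_le_iff₀ hu]
      nlinarith [mul_nonneg (sub_nonneg.2 hr_le) (sub_nonneg.2 hr_lt.le)]
    rw [← Finset.sum_range_add_sum_Ico _ hrn]
    have := htriv r hrn
    rw [mul_sub] at htail
    linarith

/-- A counter that starts at `0` and moves from `l` to `l + 1` with probability `q l` in each time
step; `π t l` is the probability that it shows `l` at time `t`. Only the values below `n` are
described, which leaves room for an absorbing end of the service. -/
structure IsCounter (n : ℕ) (q : ℕ → ℝ) (π : ℕ → ℕ → ℝ) : Prop where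
  nonneg : ∀ t l, 0 ≤ π t l
  zero : ∀ l < n, π 0 l = if l = 0 then 1 else 0
  succ_zero : ∀ t, 0 < n → π (t + 1) 0 = π t 0 * (1 - q 0)
  succ_succ : ∀ t l, l + 1 < n → π (t + 1) (l + 1) = π t (l + 1) * (1 - q (l + 1)) + π t l * q l
  sum_le_one : ∀ t, ∀ k ≤ n, ∑ l ∈ Finset.range k, π t l ≤ 1

/-- Given that the counter shows `l` at time `t`, the expected square of the deviation of the
hitting time of `k` from its mean. Here `1 / q l` is the mean and `(1 / q l)² - 1 / q l` the
variance of the time spent at `l`. -/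
noncomputable def hittingPotential (q : ℕ → ℝ) (k l t : ℕ) : ℝ :=
  (t - ∑ i ∈ Finset.range l, 1 / q i) ^ 2 + ∑ i ∈ Finset.Ico l k, ((1 / q i) ^ 2 - 1 / q i)

lemma hittingPotential_step {q : ℕ → ℝ} {k l : ℕ} (hl : l < k) (hq : 0 < q l) (t : ℕ) :
    (1 - q l) * hittingPotential q k l (t + 1) + q l * hittingPotential q k (l + 1) (t + 1)
      = hittingPotential q k l t := by
  simp only [hittingPotential, Finset.sum_range_succ, Finset.sum_eq_sum_Ico_succ_bot hl]
  generalize ∑ i ∈ Finset.range l, 1 / q i = a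
  generalize ∑ i ∈ Finset.Ico (l + 1) k, ((1 / q i) ^ 2 - 1 / q i) = b
  push_cast
  field_simp
  ring

/-- Chebyshev's inequality for the time at which the counter reaches `k`. -/
lemma IsCounter.chebyshev {n : ℕ} {q : ℕ → ℝ} {π : ℕ → ℕ → ℝ} (hπ : IsCounter n q π) {k : ℕ}
    (hk : 1 ≤ k) (hkn : k ≤ n) (hq : ∀ l < n, 0 < q l ∧ q l ≤ 1) (t : ℕ)
    (ht : ∑ i ∈ Finset.range k, 1 / q i ≤ t) :
    (∑ l ∈ Finset.range k, π t l) * (t - ∑ i ∈ Finset.range k, 1 / q i) ^ 2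
      ≤ ∑ i ∈ Finset.range k, ((1 / q i) ^ 2 - 1 / q i) := by
  have hv : ∀ i < n, 0 ≤ (1 / q i) ^ 2 - 1 / q i := fun i hi => by
    have : 1 ≤ 1 / q i := (one_le_div (hq i hi).1).2 (hq i hi).2
    nlinarith
  have hW : ∀ t, ∑ l ∈ Finset.range k, π t l * hittingPotential q k l t
      ≤ ∑ i ∈ Finset.range k, ((1 / q i) ^ 2 - 1 / q i) := by
    intro t
    induction t with
    | zero =>
      rw [Finset.sum_eq_single_of_mem 0 (Finset.mem_range.2 hk) fun l hl hl0 => by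
        rw [hπ.zero l ((Finset.mem_range.1 hl).trans_le hkn), if_neg hl0, zero_mul],
        hπ.zero 0 (by omega)]
      simp [hittingPotential]
    | succ t ih =>
      refine le_trans ?_ ih
      -- each step preserves the sum, except that the mass arriving at `k` is discarded
      obtain ⟨k', rfl⟩ : ∃ k', k = k' + 1 := ⟨k - 1, by omega⟩
      set W := hittingPotential q (k' + 1) with hWdef
      have hlast : 0 ≤ W (k' + 1) (t + 1) := by simp [W, hittingPotential, sq_nonneg]
      calc ∑ l ∈ Finset.range (k' + 1), π (t + 1) l * W l (t + 1)
          = ∑ l ∈ Finset.range (k' + 1), π t l * (1 - q l) * W l (t + 1)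
            + ∑ l ∈ Finset.range k', π t l * q l * W (l + 1) (t + 1) := by
            rw [Finset.sum_range_succ', Finset.sum_range_succ' _ k', hπ.succ_zero t (by omega),
              add_right_comm, ← Finset.sum_add_distrib]
            congr 1
            refine Finset.sum_congr rfl fun l hl => ?_
            rw [hπ.succ_succ t l (by have := Finset.mem_range.1 hl; omega)]
            ring
        _ ≤ ∑ l ∈ Finset.range (k' + 1), π t l * (1 - q l) * W l (t + 1)
            + ∑ l ∈ Finset.range (k' + 1), π t l * q l * W (l + 1) (t + 1) := by
            rw [Finset.sum_range_succ _ k', Finset.sum_range_succ _ k']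
            have := mul_nonneg (mul_nonneg (hπ.nonneg t k') (hq k' (by omega)).1.le) hlast
            linarith
        _ = ∑ l ∈ Finset.range (k' + 1), π t l * W l t := by
            rw [← Finset.sum_add_distrib]
            refine Finset.sum_congr rfl fun l hl => ?_
            rw [hWdef, ← hittingPotential_step (Finset.mem_range.1 hl)
              (hq l (by have := Finset.mem_range.1 hl; omega)).1 t]
            ring
  refine le_trans ?_ (hW t)
  rw [Finset.sum_mul]
  refine Finset.sum_le_sum fun l hl => mul_le_mul_of_nonneg_left ?_ (hπ.nonneg t l)
  have hl' : l < k := Finset.mem_range.1 hl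
  have hmono : ∑ i ∈ Finset.range l, 1 / q i ≤ ∑ i ∈ Finset.range k, 1 / q i :=
    Finset.sum_le_sum_of_subset_of_nonneg (Finset.range_mono hl'.le) fun i hi _ => by
      have := (hq i (by have := Finset.mem_range.1 hi; omega)).1
      positivity
  have hvar : 0 ≤ ∑ i ∈ Finset.Ico l k, ((1 / q i) ^ 2 - 1 / q i) :=
    Finset.sum_nonneg fun i hi => hv i (by have := Finset.mem_Ico.1 hi; omega)
  have : (t - ∑ i ∈ Finset.range k, 1 / q i) ^ 2 ≤ (t - ∑ i ∈ Finset.range l, 1 / q i) ^ 2 :=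
    pow_le_pow_left₀ (by linarith) (by linarith) 2
  rw [hittingPotential]
  linarith

/-- If the total mean time to reach `n` is at most `τ`, the expectation of the counter at time `τ`
(cut off at `n`) is at least `n - 2 √(n + 1/4)`. -/
lemma IsCounter.le_mean {n τ : ℕ} {q : ℕ → ℝ} {π : ℕ → ℕ → ℝ} (hπ : IsCounter n q π)
    (hq : ∀ l < n, 0 < q l ∧ q l ≤ 1) (hanti : ∀ k l, k ≤ l → l < n → q l ≤ q k)
    (hτ : ∑ i ∈ Finset.range n, 1 / q i ≤ τ) :
    n - 2 * √(n + 1 / 4)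
      ≤ ∑ k ∈ Finset.range n, (1 - ∑ l ∈ Finset.range (k + 1), π τ l) := by
  have hinv : ∀ k l, k ≤ l → l < n → 1 / q k ≤ 1 / q l := fun k l hkl hl =>
    one_div_le_one_div_of_le (hq l hl).1 (hanti k l hkl hl)
  have hfail : ∀ k, 1 ≤ k → k ≤ n →
      (∑ l ∈ Finset.range k, π τ l) * ((n : ℝ) - k) ^ 2 ≤ k := by
    intro k hk hkn
    set m : ℝ := 1 / q (k - 1) with hm
    have hm₀ : 0 < m := by
      have := (hq (k - 1) (by omega)).1
      positivity
    have hsplit := Finset.sum_range_add_sum_Ico (fun i => 1 / q i) hkn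
    have hrest : ((n : ℝ) - k) * m ≤ ∑ i ∈ Finset.Ico k n, 1 / q i := by
      have := Finset.card_nsmul_le_sum (Finset.Ico k n) (fun i => 1 / q i) m fun i hi => by
        rw [Finset.mem_Ico] at hi
        exact hinv _ _ (by omega) hi.2
      rwa [Nat.card_Ico, nsmul_eq_mul, Nat.cast_sub hkn] at this
    have hkn' : (0 : ℝ) ≤ n - k := sub_nonneg.2 (by exact_mod_cast hkn)
    have hδ₀ := mul_nonneg hkn' hm₀.le
    have hδ : ((n : ℝ) - k) * m ≤ τ - ∑ i ∈ Finset.range k, 1 / q i := by linarith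
    have hch := hπ.chebyshev hk hkn hq τ (by linarith)
    have hvar : ∑ i ∈ Finset.range k, ((1 / q i) ^ 2 - 1 / q i) ≤ k * m ^ 2 := by
      calc ∑ i ∈ Finset.range k, ((1 / q i) ^ 2 - 1 / q i)
          ≤ ∑ _i ∈ Finset.range k, m ^ 2 := by
            refine Finset.sum_le_sum fun i hi => ?_
            have hik := Finset.mem_range.1 hi
            have h0 : 0 < 1 / q i := one_div_pos.2 (hq i (by omega)).1
            have h1 : 1 / q i ≤ m := hinv _ _ (by omega) (by omega)
            nlinarith
        _ = k * m ^ 2 := by simp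
    have hF₀ : 0 ≤ ∑ l ∈ Finset.range k, π τ l := Finset.sum_nonneg fun l _ => hπ.nonneg τ l
    have h3 : (((n : ℝ) - k) * m) ^ 2 ≤ (τ - ∑ i ∈ Finset.range k, 1 / q i) ^ 2 :=
      pow_le_pow_left₀ hδ₀ hδ 2
    have h4 := mul_le_mul_of_nonneg_left h3 hF₀
    have h5 : (∑ l ∈ Finset.range k, π τ l) * ((n : ℝ) - k) ^ 2 * m ^ 2 ≤ k * m ^ 2 := by
      calc _ = (∑ l ∈ Finset.range k, π τ l) * (((n : ℝ) - k) * m) ^ 2 := by ring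
        _ ≤ _ := h4.trans (hch.trans hvar)
    exact le_of_mul_le_mul_right h5 (by positivity)
  have hbound := sum_tail_bound_le (n := n) (g := fun j => ∑ l ∈ Finset.range (n - j), π τ l)
    (fun j _ => hπ.sum_le_one τ _ (Nat.sub_le _ _))
    (fun j hj => by
      have := hfail (n - j) (by omega) (Nat.sub_le _ _)
      rw [Nat.cast_sub hj.le, sub_sub_cancel] at this
      exact this)
  have hreflect : ∑ j ∈ Finset.range n, ∑ l ∈ Finset.range (n - j), π τ l
      = ∑ k ∈ Finset.range n, ∑ l ∈ Finset.range (k + 1), π τ l := by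
    rw [← Finset.sum_range_reflect (fun k => ∑ l ∈ Finset.range (k + 1), π τ l) n]
    refine Finset.sum_congr rfl fun j hj => ?_
    have := Finset.mem_range.1 hj
    rw [show n - 1 - j + 1 = n - j by omega]
  rw [Finset.sum_sub_distrib, ← hreflect]
  simp only [Finset.sum_const, Finset.card_range, nsmul_eq_mul, mul_one]
  linarith

end Chain

/-! ### Static policies -/

section Static

variable {N M : ℕ}

/-- The first element of `K` that lies in a sublist is the head of the sublist. -/
lemma find?_mem_of_sublist {α : Type*} [DecidableEq α] {S K : List α} (h : S.Sublist K)
    (hK : K.Nodup) : K.find? (fun j => j ∈ S) = S.head? := by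
  induction h with
  | slnil => rfl
  | @cons S K' b hS ih =>
    have hb : b ∉ S := fun hb => (List.nodup_cons.1 hK).1 (hS.subset hb)
    rw [List.find?_cons_of_neg (by simpa using hb)]
    exact ih (List.nodup_cons.1 hK).2
  | cons_cons b hS ih => simp

/-- The clients that belong to access point `i`, in the order in which they are served. -/
def serviceList (a : Fin M → Fin N) (Γ : Fin N → Equiv.Perm (Fin M)) (i : Fin N) : List (Fin M) :=
  (List.ofFn (Γ i)).filter fun j => a j = i

lemma nodup_serviceList (a : Fin M → Fin N) (Γ : Fin N → Equiv.Perm (Fin M)) (i : Fin N) :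
    (serviceList a Γ i).Nodup :=
  (List.nodup_ofFn_ofInjective (Γ i).injective).filter _

lemma mem_serviceList {a : Fin M → Fin N} {Γ : Fin N → Equiv.Perm (Fin M)} {i : Fin N}
    {j : Fin M} : j ∈ serviceList a Γ i ↔ a j = i := by
  simp only [serviceList, List.mem_filter, List.mem_ofFn, decide_eq_true_eq, and_iff_right_iff_imp]
  exact fun _ => (Γ i).surjective j

/-- How many packets of the list `K` access point `i` delivers in `s` time slots, when it serves
them one after the other. -/
def counter (i : Fin N) (K : List (Fin M)) (ch : ℕ → Fin N → Fin M → Bool) : ℕ → ℕ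
  | 0 => 0
  | s + 1 => if (K[counter i K ch s]?).any (ch s i) then counter i K ch s + 1
      else counter i K ch s

lemma counter_le_length (i : Fin N) (K : List (Fin M)) (ch : ℕ → Fin N → Fin M → Bool) (s : ℕ) :
    counter i K ch s ≤ K.length := by
  induction s with
  | zero => exact Nat.zero_le _
  | succ s ih =>
    rw [counter]
    split_ifs with h
    · by_contra! hlt
      rw [List.getElem?_eq_none (by omega)] at h
      simp at h
    · exact ih

lemma dependsOn_counter (i : Fin N) (K : List (Fin M)) (s : ℕ) :
    DependsOn (fun w : ℕ → Fin N → Fin M → Bool => counter i K w s)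
      (Finset.range s : Set ℕ) := by
  induction s with
  | zero => intro w w' _; rfl
  | succ s ih =>
    intro w w' hw
    have h₁ : counter i K w s = counter i K w' s :=
      ih fun t ht => hw t (by simp only [Finset.coe_range, Set.mem_Iio] at ht ⊢; omega)
    have h₂ : w s = w' s := hw _ (by simp)
    simp only [counter, h₁, h₂]

variable (a : Fin M → Fin N) (Γ : Fin N → Equiv.Perm (Fin M))

lemma served_staticPolicy {H : History N M} {i : Fin N} {l : ℕ}
    (hH : buffer H i = ((serviceList a Γ i).drop l).toFinset) :
    served (staticPolicy a Γ) H i = (serviceList a Γ i)[l]? := by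
  have h₁ : (staticPolicy a Γ).transmit H i = (serviceList a Γ i)[l]? := by
    simp only [staticPolicy, hH, List.mem_toFinset]
    rw [find?_mem_of_sublist (S := (serviceList a Γ i).drop l)
      ((List.drop_sublist l _).trans List.filter_sublist)
      (List.nodup_ofFn_ofInjective (Γ i).injective), List.head?_drop]
  rw [served, h₁]
  rcases hj : (serviceList a Γ i)[l]? with _ | j
  · rfl
  · have hmem : j ∈ buffer H i := by
      rw [hH, List.mem_toFinset, List.mem_iff_getElem?]
      exact ⟨0, by simpa using hj⟩
    simp [Option.filter, hmem]

/-- The packets still held are those after the first `counter` ones in the service order; nothing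
but the channel during the interval matters. -/
lemma buffer_staticPolicy (ch : ℕ → Fin N → Fin M → Bool) (h : History N M) (s : ℕ) (i : Fin N) :
    buffer (intervalHist (staticPolicy a Γ) ch h s) i
      = ((serviceList a Γ i).drop (counter i (serviceList a Γ i) ch s)).toFinset := by
  induction s with
  | zero =>
    ext j
    simp [intervalHist, buffer, counter, mem_serviceList, staticPolicy]
  | succ s ih =>
    ext j
    rw [mem_buffer_succ, served_staticPolicy a Γ ih, ih]
    set K := serviceList a Γ i with hK
    set l := counter i K ch s with hl
    have hnd : (K.drop l).Nodup := (nodup_serviceList a Γ i).sublist (List.drop_sublist _ _)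
    rw [counter, ← hl]
    rcases lt_or_ge l K.length with hlt | hge
    · rw [List.getElem?_eq_getElem hlt]
      rw [List.drop_eq_getElem_cons hlt] at hnd ⊢
      have hn := (List.nodup_cons.1 hnd).1
      by_cases hch : ch s i K[l] = true
      · simp only [hch, Option.any_some, if_true, List.mem_toFinset, List.mem_cons]
        constructor
        · rintro ⟨rfl | hj, hne⟩
          · exact absurd ⟨rfl, hch⟩ hne
          · exact hj
        · intro hj
          refine ⟨Or.inr hj, ?_⟩
          rintro ⟨he, -⟩
          rw [Option.some_inj] at he
          exact hn (he ▸ hj)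
      · simp only [hch, Option.any_some, List.mem_toFinset]
        rw [if_neg (by simp), List.drop_eq_getElem_cons hlt]
        refine and_iff_left ?_
        rintro ⟨he, hb⟩
        rw [Option.some_inj] at he
        exact hch (he ▸ hb)
    · rw [List.getElem?_eq_none hge]
      simp

lemma mem_delivered_staticPolicy {ch : ℕ → Fin N → Fin M → Bool} {h : History N M} {s : ℕ}
    {j : Fin M} :
    j ∈ delivered (intervalHist (staticPolicy a Γ) ch h s) ↔
      j ∉ (serviceList a Γ (a j)).drop (counter (a j) (serviceList a Γ (a j)) ch s) := by
  have h₁ := mem_buffer_iff (staticPolicy a Γ) ch h (s := s) (i := a j) (j := j)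
  rw [buffer_staticPolicy, List.mem_toFinset] at h₁
  rw [h₁]
  simp [staticPolicy]

/-- The packets delivered within an interval, counted access point by access point. -/
lemma sum_delivered_staticPolicy (ch : ℕ → Fin N → Fin M → Bool) (h : History N M) (s : ℕ) :
    ∑ j, (if j ∈ delivered (intervalHist (staticPolicy a Γ) ch h s) then (1 : ℝ) else 0)
      = ∑ i, (counter i (serviceList a Γ i) ch s : ℝ) := by
  rw [← Finset.sum_fiberwise Finset.univ a]
  refine Finset.sum_congr rfl fun i _ => ?_
  set K := serviceList a Γ i with hK
  set l := counter i K ch s with hl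
  have hnd : K.Nodup := nodup_serviceList a Γ i
  have hset : (Finset.univ.filter fun j => a j = i) = K.toFinset := by
    ext j; simp [hK, mem_serviceList]
  have hsub : (K.drop l).toFinset ⊆ K.toFinset := fun j hj => by
    rw [List.mem_toFinset] at hj ⊢
    exact List.mem_of_mem_drop hj
  calc ∑ j with a j = i, (if j ∈ delivered (intervalHist (staticPolicy a Γ) ch h s)
        then (1 : ℝ) else 0)
      = ∑ j ∈ K.toFinset, (if j ∉ (K.drop l).toFinset then (1 : ℝ) else 0) := by
        rw [← hset]
        refine Finset.sum_congr rfl fun j hj => ?_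
        obtain rfl := (Finset.mem_filter.1 hj).2
        simp only [mem_delivered_staticPolicy, List.mem_toFinset, hl, hK]
    _ = ((K.toFinset \ (K.drop l).toFinset).card : ℝ) := by
        rw [Finset.sum_boole, Finset.sdiff_eq_filter]
    _ = l := by
        rw [Finset.card_sdiff_of_subset hsub, List.toFinset_card_of_nodup hnd,
          List.toFinset_card_of_nodup (hnd.sublist (List.drop_sublist _ _)), List.length_drop]
        have : l ≤ K.length := counter_le_length i K ch s
        congr 1
        omega

end Static

/-! ### The mean number of deliveries of a greedy access point -/

section Greedy

variable {Ω : Type*} [MeasurableSpace Ω] {μ : Measure Ω} [IsProbabilityMeasure μ] {N M : ℕ}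
  {p : Fin N → Fin M → ℝ} {c : ℕ → Fin N → Fin M → Ω → Bool}

lemma dependsOn_counter_eq (i : Fin N) (K : List (Fin M)) (s l : ℕ) :
    DependsOn (fun w : ℕ → Fin N → Fin M → Bool => if counter i K w s = l then (1 : ℝ) else 0)
      (Finset.range s : Set ℕ) := fun x y hxy => by
  have := dependsOn_counter i K s hxy
  simp only at this
  simp only [this]

lemma sum_counter_eq (i : Fin N) (K : List (Fin M)) (w : ℕ → Fin N → Fin M → Bool) (s k : ℕ) :
    ∑ l ∈ Finset.range k, (if counter i K w s = l then (1 : ℝ) else 0)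
      = if counter i K w s < k then 1 else 0 := by
  simp

lemma counter_succ_eq_zero {i : Fin N} {K : List (Fin M)} {w : ℕ → Fin N → Fin M → Bool} {s : ℕ}
    (hK : 0 < K.length) :
    (if counter i K w (s + 1) = 0 then (1 : ℝ) else 0)
      = (if counter i K w s = 0 then 1 else 0)
        - (if counter i K w s = 0 then 1 else 0) * (if w s i K[0] = true then 1 else 0) := by
  rw [counter]
  by_cases h : counter i K w s = 0
  · rw [h, List.getElem?_eq_getElem hK, Option.any_some]
    by_cases hw : w s i K[0] = true <;> simp [hw]
  · split_ifs <;> simp_all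

lemma counter_succ_eq_succ {i : Fin N} {K : List (Fin M)} {w : ℕ → Fin N → Fin M → Bool}
    {s l : ℕ} (hl : l + 1 < K.length) :
    (if counter i K w (s + 1) = l + 1 then (1 : ℝ) else 0)
      = (if counter i K w s = l + 1 then 1 else 0)
        - (if counter i K w s = l + 1 then 1 else 0) * (if w s i K[l + 1] = true then 1 else 0)
        + (if counter i K w s = l then 1 else 0)
          * (if w s i (K[l]'(by omega)) = true then 1 else 0) := by
  rw [counter]
  by_cases h : counter i K w s = l + 1
  · rw [h, List.getElem?_eq_getElem hl, Option.any_some]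
    by_cases hw : w s i K[l + 1] = true <;> simp [hw]
  · by_cases h' : counter i K w s = l
    · rw [h', List.getElem?_eq_getElem (by omega), Option.any_some]
      by_cases hw : w s i (K[l]'(by omega)) = true <;> simp [hw]
    · simp only [h, h', if_false, zero_mul, sub_zero, add_zero]
      split_ifs <;> first | omega | rfl

/-- The number of deliveries of an access point with a static order is a counter in the sense of
`IsCounter`. -/
lemma IsErasureNetwork.isCounter (hc : IsErasureNetwork μ p c) (hp : ∀ i j, 0 ≤ p i j)
    (i : Fin N) (K : List (Fin M)) {n : ℕ} (hn : n ≤ K.length) :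
    IsCounter n (fun l => (K[l]?).elim 0 (p i))
      (fun t l => ∫ ω, (if counter i K (path c ω) t = l then (1 : ℝ) else 0) ∂μ) := by
  have hint : ∀ t l, Integrable (fun ω => if counter i K (path c ω) t = l then (1 : ℝ) else 0) μ :=
    fun t l => hc.integrable_of_dependsOn (dependsOn_counter_eq i K t l)
  have hprod : ∀ t l j, ∫ ω, (if counter i K (path c ω) t = l then (1 : ℝ) else 0)
      * (if path c ω t i j = true then 1 else 0) ∂μ
      = p i j * ∫ ω, (if counter i K (path c ω) t = l then (1 : ℝ) else 0) ∂μ := fun t l j =>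
    hc.integral_mul_channel hp (by simp) (dependsOn_counter_eq i K t l) i j
  have hint' : ∀ t l j, Integrable (fun ω => (if counter i K (path c ω) t = l then (1 : ℝ) else 0)
      * (if path c ω t i j = true then 1 else 0)) μ := fun t l j =>
    hc.integrable_of_dependsOn (I := Finset.range (t + 1))
      (f := fun w => (if counter i K w t = l then (1 : ℝ) else 0)
        * (if w t i j = true then 1 else 0)) fun x y hxy => by
      have h₁ := dependsOn_counter_eq i K t l (x := x) (y := y) fun s hs => hxy s (by
        simp only [Finset.coe_range, Set.mem_Iio] at hs ⊢; omega)
      have h₂ : x t = y t := hxy t (by simp)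
      simp only at h₁
      simp only [h₁, h₂]
  refine ⟨fun t l => integral_nonneg fun ω => ?_, fun l _ => ?_, fun t h0 => ?_, fun t l hl => ?_,
    fun t k _ => ?_⟩
  · simp only [Pi.zero_apply]; split_ifs <;> norm_num
  · simp only [counter, eq_comm (a := 0)]
    simp
  · simp only [counter_succ_eq_zero (h0.trans_le hn), List.getElem?_eq_getElem (h0.trans_le hn),
      Option.elim_some]
    rw [integral_sub (hint _ _) (hint' _ _ _), hprod]
    ring
  · have hl' : l + 1 < K.length := hl.trans_le hn
    simp only [counter_succ_eq_succ hl', List.getElem?_eq_getElem hl',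
      List.getElem?_eq_getElem (Nat.lt_of_succ_lt hl'), Option.elim_some]
    have hsub : Integrable (fun ω => (if counter i K (path c ω) t = l + 1 then (1 : ℝ) else 0)
        - (if counter i K (path c ω) t = l + 1 then 1 else 0)
          * (if path c ω t i K[l + 1] = true then 1 else 0)) μ := (hint _ _).sub (hint' _ _ _)
    rw [integral_add hsub (hint' _ _ _),
      integral_sub (hint _ _) (hint' _ _ _), hprod, hprod]
    ring
  · rw [← integral_finsetSum _ fun l _ => hint t l]
    calc _ ≤ ∫ _, (1 : ℝ) ∂μ := by
          refine integral_mono (integrable_finsetSum _ fun l _ => hint t l)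
            (integrable_const _) fun ω => ?_
          simp only [sum_counter_eq]
          split_ifs <;> norm_num
      _ = 1 := by simp

/-- The clients of a feasible solution of the relaxed problem have positive success
probabilities, and their mean service times add up to at most `τ`. -/
lemma RelaxedFeasible.pos_and_sum_le {τ : ℕ} {x : Fin N → Fin M → ℕ}
    (hp : ∀ i j, 0 ≤ p i j) (hx : RelaxedFeasible τ p x) (i : Fin N) :
    (∀ j, x i j = 1 → 0 < p i j) ∧ ∑ j with x i j = 1, 1 / p i j ≤ τ := by
  have hpos : ∀ j, x i j = 1 → 0 < p i j := fun j hj => by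
    refine (hp i j).lt_of_ne fun h0 => ?_
    have h₁ := (Finset.single_le_sum (f := fun j => (x i j : ENNReal) / ENNReal.ofReal (p i j))
      (fun _ _ => zero_le) (Finset.mem_univ j)).trans (hx.capacity i)
    simp [hj, ← h0] at h₁
  refine ⟨hpos, ?_⟩
  have h₁ : ENNReal.ofReal (∑ j with x i j = 1, 1 / p i j) ≤ ENNReal.ofReal τ := by
    rw [ENNReal.ofReal_natCast, ENNReal.ofReal_sum_of_nonneg fun j _ =>
      div_nonneg zero_le_one (hp i j)]
    refine le_trans ?_ (hx.capacity i)
    refine le_trans (Finset.sum_le_sum (g := fun j => (x i j : ENNReal) / ENNReal.ofReal (p i j))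
      fun j hj => ?_) (Finset.sum_le_univ_sum_of_nonneg fun j => zero_le)
    have hj := (Finset.mem_filter.1 hj).2
    rw [ENNReal.ofReal_div_of_pos (hpos j hj), hj]
    simp
  exact (ENNReal.ofReal_le_ofReal_iff (Nat.cast_nonneg τ)).1 h₁

lemma IsGreedy.pairwise_serviceList {a : Fin M → Fin N} {Γ : Fin N → Equiv.Perm (Fin M)}
    (hΓ : IsGreedy p a Γ) (i : Fin N) :
    (serviceList a Γ i).Pairwise fun j j' => p i j' ≤ p i j := by
  rw [serviceList, List.pairwise_filter, List.pairwise_ofFn]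
  intro k l hkl h₁ h₂
  exact hΓ i k l hkl (by simpa using h₁) (by simpa using h₂)

/-- A greedy access point that owns `n` clients of a feasible solution of the relaxed problem
delivers at least `n - 2 √(n + 1/4)` packets per interval on average. It may own further clients,
but the first `n` clients in its order have the smallest mean service times. -/
lemma IsErasureNetwork.le_integral_counter (hc : IsErasureNetwork μ p c)
    (hp : ∀ i j, 0 ≤ p i j ∧ p i j ≤ 1) {τ : ℕ} {x : Fin N → Fin M → ℕ}
    (hx : RelaxedFeasible τ p x) {a : Fin M → Fin N} (ha : ∀ i j, x i j = 1 → a j = i)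
    {Γ : Fin N → Equiv.Perm (Fin M)} (hΓ : IsGreedy p a Γ) (i : Fin N) :
    (∑ j, (x i j : ℝ)) - 2 * √(∑ j, (x i j : ℝ) + 1 / 4)
      ≤ ∫ ω, (counter i (serviceList a Γ i) (path c ω) τ : ℝ) ∂μ := by
  have hp₀ : ∀ i j, 0 ≤ p i j := fun i j => (hp i j).1
  set K := serviceList a Γ i with hK
  have hsort := hΓ.pairwise_serviceList i
  rw [← hK] at hsort
  obtain ⟨hpos, hsum⟩ := hx.pos_and_sum_le hp₀ i
  set X := K.filter fun j => x i j = 1 with hX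
  have hXnd : X.Nodup := (nodup_serviceList a Γ i).filter _
  have hXset : X.toFinset = Finset.univ.filter fun j => x i j = 1 := by
    ext j
    simp only [hX, hK, List.mem_toFinset, List.mem_filter, mem_serviceList, Finset.mem_filter,
      Finset.mem_univ, true_and, decide_eq_true_eq]
    exact ⟨fun h => h.2, fun h => ⟨ha i j h, h⟩⟩
  set n := X.length with hn
  have hcard : ∑ j, (x i j : ℝ) = n := by
    rw [hn, ← List.toFinset_card_of_nodup hXnd, hXset, ← Finset.sum_boole]
    refine Finset.sum_congr rfl fun j _ => ?_
    rcases hx.binary i j with h | h <;> simp [h]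
  have hsubl : X.Sublist K := List.filter_sublist
  obtain ⟨f, hf⟩ := List.sublist_iff_exists_fin_orderEmbedding_get_eq.1 hsubl
  have hnK : n ≤ K.length := hsubl.length_le
  -- the `k`-th client of the relaxed solution is served no earlier than as the `k`-th of all
  have hfk : ∀ k : ℕ, ∀ hk : k < n, k ≤ (f ⟨k, hk⟩ : ℕ) := by
    intro k
    induction k with
    | zero => intro _; exact Nat.zero_le _
    | succ k ih =>
      intro hk
      have h₁ := ih (by omega)
      have h₂ : f ⟨k, by omega⟩ < f ⟨k + 1, hk⟩ := f.strictMono (by simp [Fin.lt_def])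
      have h₃ : (f ⟨k, by omega⟩ : ℕ) < f ⟨k + 1, hk⟩ := h₂
      omega
  have hmono : ∀ k l (hkl : k ≤ l) (hl : l < K.length), p i K[l] ≤ p i (K[k]'(by omega)) := by
    intro k l hkl hl
    rcases hkl.eq_or_lt with rfl | hlt
    · exact le_rfl
    · exact List.pairwise_iff_getElem.1 hsort k l _ hl hlt
  have hXK : ∀ k (hk : k < n), p i X[k] ≤ p i (K[k]'(by omega)) := by
    intro k hk
    have h₁ := hf ⟨k, hk⟩
    simp only [List.get_eq_getElem] at h₁
    rw [h₁]
    exact hmono _ _ (hfk k hk) _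
  have hXpos : ∀ k (hk : k < n), 0 < p i X[k] := by
    intro k hk
    refine hpos _ ?_
    have hmem : X[k] ∈ X.toFinset := List.mem_toFinset.2 (List.getElem_mem hk)
    rw [hXset] at hmem
    exact (Finset.mem_filter.1 hmem).2
  set q : ℕ → ℝ := fun l => (K[l]?).elim 0 (p i) with hq
  have hqK : ∀ l (hl : l < n), q l = p i (K[l]'(by omega)) := fun l hl => by
    simp [hq, List.getElem?_eq_getElem (show l < K.length by omega)]
  have hτ : ∑ l ∈ Finset.range n, 1 / q l ≤ τ := by
    refine le_trans ?_ hsum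
    rw [← hXset, List.sum_toFinset _ hXnd, ← Fin.sum_univ_fun_getElem, Finset.sum_range]
    refine Finset.sum_le_sum fun k _ => ?_
    rw [hqK k k.2]
    exact one_div_le_one_div_of_le (hXpos k k.2) (hXK k k.2)
  have hcounter := hc.isCounter hp₀ i K hnK
  have hmean := hcounter.le_mean (τ := τ)
    (fun l hl => by
      have h₁ := hqK l hl
      have : 0 < q l ∧ q l ≤ 1 := by
        rw [h₁]; exact ⟨(hXpos l hl).trans_le (hXK l hl), (hp _ _).2⟩
      exact this)
    (fun k l hkl hl => by
      have : q l ≤ q k := by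
        rw [hqK l hl, hqK k (by omega)]; exact hmono k l hkl _
      exact this)
    hτ
  rw [hcard]
  refine hmean.trans ?_
  have hint : ∀ l, Integrable
      (fun ω => if counter i K (path c ω) τ = l then (1 : ℝ) else 0) μ :=
    fun l => hc.integrable_of_dependsOn (dependsOn_counter_eq i K τ l)
  have hint₂ : ∀ k, Integrable (fun ω => 1 - ∑ l ∈ Finset.range (k + 1),
      (if counter i K (path c ω) τ = l then (1 : ℝ) else 0)) μ := fun k =>
    (integrable_const _).sub (integrable_finsetSum _ fun l _ => hint l)
  have hrw : ∀ k, 1 - ∑ l ∈ Finset.range (k + 1),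
      ∫ ω, (if counter i K (path c ω) τ = l then (1 : ℝ) else 0) ∂μ
      = ∫ ω, (1 - ∑ l ∈ Finset.range (k + 1),
        (if counter i K (path c ω) τ = l then (1 : ℝ) else 0)) ∂μ := fun k => by
    rw [integral_sub (integrable_const _) (integrable_finsetSum _ fun l _ => hint l),
      integral_finsetSum _ fun l _ => hint l]
    simp
  simp only [hrw]
  rw [← integral_finsetSum _ fun k _ => hint₂ k]
  refine integral_mono (integrable_finsetSum _ fun k _ => hint₂ k)
    (hc.integrable_of_dependsOn (I := Finset.range τ) (f := fun w => (counter i K w τ : ℝ))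
      fun x y hxy => ?_) fun ω => ?_
  · have := dependsOn_counter i K τ hxy
    simp only at this
    simp only [this]
  -- the sum is the counter cut off at `n`
  · simp only [sum_counter_eq]
    calc ∑ k ∈ Finset.range n, (1 - if counter i K (path c ω) τ < k + 1 then (1 : ℝ) else 0)
        = ∑ k ∈ Finset.range n, (if k < counter i K (path c ω) τ then (1 : ℝ) else 0) := by
          refine Finset.sum_congr rfl fun k _ => ?_
          split_ifs <;> first | omega | norm_num
      _ = (((Finset.range n).filter fun k => k < counter i K (path c ω) τ).card : ℝ) :=
          Finset.sum_boole _ _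
      _ ≤ ((Finset.range (counter i K (path c ω) τ)).card : ℝ) := by
          refine Nat.cast_le.2 (Finset.card_le_card fun k hk => ?_)
          exact Finset.mem_range.2 (Finset.mem_filter.1 hk).2
      _ = counter i K (path c ω) τ := by simp

end Greedy

/-! ### The timely throughput of a greedy static policy -/

section Throughput

variable {Ω : Type*} [MeasurableSpace Ω] {μ : Measure Ω} [IsProbabilityMeasure μ] {N M τ : ℕ}
  {p : Fin N → Fin M → ℝ} {c : ℕ → Fin N → Fin M → Ω → Bool}

lemma asLimsup_eq_of_tendsto {X : ℕ → Ω → ℝ} {e : ℝ}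
    (h : ∀ᵐ ω ∂μ, Tendsto (fun r => X r ω) atTop (nhds e)) : asLimsup μ X = e := by
  have hset : {R : ℝ | ∀ᵐ ω ∂μ, R ≤ limsup (fun r => X r ω) atTop} = Set.Iic e := by
    ext R
    have h₁ : (∀ᵐ ω ∂μ, R ≤ limsup (fun r => X r ω) atTop) ↔ ∀ᵐ _ω ∂μ, R ≤ e :=
      eventually_congr (h.mono fun ω hω => by rw [hω.limsup_eq])
    exact h₁.trans eventually_const
  rw [asLimsup, hset, csSup_Iic]

/-- The strong law of large numbers for the successive intervals. -/
lemma IsErasureNetwork.ae_tendsto_average (hc : IsErasureNetwork μ p c)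
    {F : (ℕ → Fin N → Fin M → Bool) → ℝ} (hF : DependsOn F (Finset.range τ : Set ℕ)) :
    ∀ᵐ ω ∂μ, Tendsto
      (fun n : ℕ => (∑ r ∈ Finset.range n, F fun s => path c ω (r * τ + s)) / n) atTop
      (nhds (∫ ω, F (path c ω) ∂μ)) := by
  have hdep : ∀ r, DependsOn (fun w : ℕ → Fin N → Fin M → Bool => F fun s => w (r * τ + s))
      (Finset.Ico (r * τ) (r * τ + τ) : Set ℕ) := fun r x y hxy => hF fun s hs => hxy _ (by
    simp only [Finset.coe_range, Set.mem_Iio, Finset.coe_Ico, Set.mem_Ico] at hs ⊢; omega)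
  have hdisj : ∀ r s, r < s →
      Disjoint (Finset.Ico (r * τ) (r * τ + τ)) (Finset.Ico (s * τ) (s * τ + τ)) := by
    intro r s hrs
    rw [Finset.disjoint_left]
    intro t ht ht'
    rw [Finset.mem_Ico] at ht ht'
    have : (r + 1) * τ ≤ s * τ := Nat.mul_le_mul_right _ hrs
    rw [Nat.succ_mul] at this
    omega
  have hid := hc.identDistrib_shift hF
  have h := strong_law_ae_real (μ := μ) (fun r ω => F fun s => path c ω (r * τ + s))
    (hc.integrable_of_dependsOn (hdep 0))
    (fun r s hrs => by
      rcases lt_or_gt_of_ne hrs with hlt | hlt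
      · exact hc.indepFun_of_dependsOn (hdisj r s hlt) (hdep r) (hdep s)
      · exact (hc.indepFun_of_dependsOn (hdisj s r hlt) (hdep s) (hdep r)).symm)
    (fun r => (hid (r * τ)).trans (hid (0 * τ)).symm)
  simpa only [zero_mul, zero_add] using h

variable (a : Fin M → Fin N) (Γ : Fin N → Equiv.Perm (Fin M))

/-- Both notions of throughput of a static policy are the expected numbers of deliveries within a
single interval. -/
lemma IsErasureNetwork.throughput_staticPolicy (hc : IsErasureNetwork μ p c) :
    totalTimelyThroughput μ τ c (staticPolicy a Γ)
        = ∑ j, timelyThroughput μ τ c (staticPolicy a Γ) j ∧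
      ∑ j, timelyThroughput μ τ c (staticPolicy a Γ) j
        = ∑ i, ∫ ω, (counter i (serviceList a Γ i) (path c ω) τ : ℝ) ∂μ := by
  set F : Fin M → (ℕ → Fin N → Fin M → Bool) → ℝ := fun j w =>
    if j ∈ delivered (intervalHist (staticPolicy a Γ) w [] τ) then 1 else 0 with hF
  have hFdep : ∀ j, DependsOn (F j) (Finset.range τ : Set ℕ) := fun j x y hxy => by
    have := dependsOn_counter (a j) (serviceList a Γ (a j)) τ hxy
    simp only at this
    simp only [hF, mem_delivered_staticPolicy, this]
  have hnum : ∀ (w : ℕ → Fin N → Fin M → Bool) r j,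
      (numDelivered (staticPolicy a Γ) τ w r j : ℝ) = F j fun s => w (r * τ + s) := by
    intro w r j
    simp only [numDelivered, hist, hF, mem_delivered_staticPolicy]
    split_ifs <;> simp
  have hlim := fun j => hc.ae_tendsto_average (hFdep j)
  have hR : ∀ j, timelyThroughput μ τ c (staticPolicy a Γ) j = ∫ ω, F j (path c ω) ∂μ := by
    intro j
    refine asLimsup_eq_of_tendsto ((hlim j).mono fun ω hω => ?_)
    simp only [hnum]
    exact hω
  have hT : totalTimelyThroughput μ τ c (staticPolicy a Γ) = ∑ j, ∫ ω, F j (path c ω) ∂μ := by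
    refine asLimsup_eq_of_tendsto ((ae_all_iff.2 hlim).mono fun ω hω => ?_)
    have := tendsto_finsetSum Finset.univ fun j _ => hω j
    refine this.congr fun n => ?_
    rw [← Finset.sum_div, Finset.sum_comm]
    simp only [hnum]
    rfl
  refine ⟨by simp only [hT, hR], ?_⟩
  have hcint : ∀ i, Integrable
      (fun ω => (counter i (serviceList a Γ i) (path c ω) τ : ℝ)) μ := fun i =>
    hc.integrable_of_dependsOn (I := Finset.range τ)
      (f := fun w => (counter i (serviceList a Γ i) w τ : ℝ)) fun x y hxy => by
        have := dependsOn_counter i (serviceList a Γ i) τ hxy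
        simp only at this
        simp only [this]
  simp only [hR]
  rw [← integral_finsetSum _ fun j _ => hc.integrable_of_dependsOn (hFdep j),
    ← integral_finsetSum _ fun i _ => hcint i]
  exact integral_congr_ae (ae_of_all _ fun ω => sum_delivered_staticPolicy a Γ _ _ _)

/-- The bounds for the individual access points, added up with the Cauchy–Schwarz inequality. -/
lemma le_sum_sub_sqrt (n : Fin N → ℝ) (hn : ∀ i, 0 ≤ n i) :
    ∑ i, n i - 2 * √(N * (∑ i, n i + N / 4)) ≤ ∑ i, (n i - 2 * √(n i + 1 / 4)) := by
  have h₁ : ∑ i, √(n i + 1 / 4) ≤ √(N * (∑ i, n i + N / 4)) := by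
    refine Real.le_sqrt_of_sq_le ?_
    have h₂ := sq_sum_le_card_mul_sum_sq (s := Finset.univ) (f := fun i => √(n i + 1 / 4))
    have h₃ : ∀ i, √(n i + 1 / 4) ^ 2 = n i + 1 / 4 := fun i =>
      Real.sq_sqrt (by linarith [hn i])
    simp only [h₃, Finset.sum_add_distrib, Finset.card_univ, Fintype.card_fin, Finset.sum_const,
      nsmul_eq_mul, mul_one_div] at h₂
    exact h₂
  rw [Finset.sum_sub_distrib, ← Finset.mul_sum]
  linarith

/-- `D ↦ D - 2 √(N (D + N/4)) = (√(D + N/4) - √N)² - 5N/4` is monotone on `D ≥ 3N/4`. -/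
lemma sub_sqrt_mono {n C D : ℝ} (hn : 0 ≤ n) (hC : 7 * n / 4 ≤ C) (hD : C ≤ D + n) :
    C - n - 2 * √(n * (C - 3 * n / 4)) ≤ D - 2 * √(n * (D + n / 4)) := by
  rw [Real.sqrt_mul hn, Real.sqrt_mul hn]
  have h₁ : √(C - 3 * n / 4) ≤ √(D + n / 4) := Real.sqrt_le_sqrt (by linarith)
  have h₂ : √n ≤ √(C - 3 * n / 4) := Real.sqrt_le_sqrt (by linarith)
  have h₃ := Real.sq_sqrt (show 0 ≤ C - 3 * n / 4 by linarith)
  have h₄ := Real.sq_sqrt (show 0 ≤ D + n / 4 by linarith)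
  nlinarith [mul_nonneg (sub_nonneg.2 h₁) (sub_nonneg.2 h₂),
    mul_nonneg (sub_nonneg.2 h₁) (sub_nonneg.2 (h₂.trans h₁))]

end Throughput

end TimelyThroughput

theorem corollary1 {Ω : Type*} [MeasurableSpace Ω] (μ : MeasureTheory.Measure Ω)
    [MeasureTheory.IsProbabilityMeasure μ] (N M τ : ℕ) (hN : 1 ≤ N) (hτ : 1 ≤ τ)
    (p : Fin N → Fin M → ℝ) (hp : ∀ i j, 0 ≤ p i j ∧ p i j ≤ 1)
    (c : ℕ → Fin N → Fin M → Ω → Bool) (hc : TimelyThroughput.IsErasureNetwork μ p c)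
    (hC : 7 * (N : ℝ) / 4 ≤ TimelyThroughput.totalCapacity μ τ c)
    (x : Fin N → Fin M → ℕ) (hx : TimelyThroughput.RelaxedOptimal τ p x)
    (a : Fin M → Fin N) (ha : ∀ i j, x i j = 1 → a j = i)
    (Γ : Fin N → Equiv.Perm (Fin M)) (hΓ : TimelyThroughput.IsGreedy p a Γ) :
    TimelyThroughput.totalTimelyThroughput μ τ c (TimelyThroughput.staticPolicy a Γ)
        = ∑ j, TimelyThroughput.timelyThroughput μ τ c (TimelyThroughput.staticPolicy a Γ) j ∧
      TimelyThroughput.totalCapacity μ τ c - N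
          - 2 * √(N * (TimelyThroughput.totalCapacity μ τ c - 3 * (N : ℝ) / 4))
        ≤ ∑ j, TimelyThroughput.timelyThroughput μ τ c (TimelyThroughput.staticPolicy a Γ) j ∧
      ∑ j, TimelyThroughput.timelyThroughput μ τ c (TimelyThroughput.staticPolicy a Γ) j
        ≤ TimelyThroughput.totalCapacity μ τ c := by
  have hp₀ : ∀ i j, 0 ≤ p i j := fun i j => (hp i j).1
  obtain ⟨hT, hR⟩ := hc.throughput_staticPolicy (τ := τ) a Γ
  have hupper : ∀ η : TimelyThroughput.Policy N M,
      TimelyThroughput.totalTimelyThroughput μ τ c η ≤ ∑ i, ∑ j, (x i j : ℝ) + N := fun η =>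
    hc.totalTimelyThroughput_le η (by positivity) fun h k => hc.integral_deliveries_le hp₀ hx η h k
  have hCD : TimelyThroughput.totalCapacity μ τ c ≤ ∑ i, ∑ j, (x i j : ℝ) + N := by
    have : Nonempty (TimelyThroughput.Policy N M) := ⟨TimelyThroughput.staticPolicy a Γ⟩
    exact ciSup_le hupper
  have hle : TimelyThroughput.totalTimelyThroughput μ τ c (TimelyThroughput.staticPolicy a Γ)
      ≤ TimelyThroughput.totalCapacity μ τ c :=
    le_ciSup (f := fun η => TimelyThroughput.totalTimelyThroughput μ τ c η)
      ⟨_, Set.forall_mem_range.2 hupper⟩ _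
  refine ⟨hT, ?_, hT ▸ hle⟩
  rw [hR]
  calc _ ≤ ∑ i, ∑ j, (x i j : ℝ) - 2 * √(N * (∑ i, ∑ j, (x i j : ℝ) + N / 4)) :=
        TimelyThroughput.sub_sqrt_mono (Nat.cast_nonneg N) hC hCD
    _ ≤ ∑ i, (∑ j, (x i j : ℝ) - 2 * √(∑ j, (x i j : ℝ) + 1 / 4)) :=
        TimelyThroughput.le_sum_sub_sqrt _ fun i => by positivity
    _ ≤ _ := Finset.sum_le_sum fun i _ => hc.le_integral_counter hp hx.1 ha hΓ i
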